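/- **Definitions.** Let $\mathcal Q$ be a set of words on the letters $\bullet,\blacklozenge,\blacktriangle$. A word $w_1\cdots w_k\in\mathcal Q$ is identified with the necklace whose pearls are, in clockwise cyclic order, $\square,w_1,\dots,w_k$. All trees below are finite plane trees whose vertices are copies of necklaces of $\mathcal Q$ and whose edges join pearls of different vertices, each pearl being incident to at most one edge; a pearl incident to no edge is *free*, one free pearl is distinguished as the root, and the size $|\tau|$ of a tree $\tau$ is its number of vertices. A *rooted $\mathcal Q$-tree* is such a tree, rooted at a $\square$-pearl, all of whose edges are of type $\bullet$–$\square$ or $\blacklozenge$–$\square$ and whose free pearls are exactly the root and the $\blacktriangle$-pearls. The excess of a pearl $x$ is the number of $\blacktriangle$-pearls minus the number of $\blacklozenge$-pearls in the subtree planted at $x$ ($x$ included); the excess of the tree is that of its root. The tree is *non-negative* if every pearl has non-negative excess. Let $\mathcal F_0$ be the set of non-negative $\mathcal Q$-trees with excess $0$, and $\mathcal F_0^{\blacklozenge}$ the set of trees of $\mathcal F_0$ with a marked $\blacklozenge$-pearl. A *$\square$-rooted $\mathcal Q$-companion tree without defects* is such a tree, rooted at a $\square$-pearl, all of whose edges are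 of type $\bullet$–$\square$ or $\blacklozenge$–$\blacktriangle$, and all of whose free pearls are $\square$-pearls. Let $\mathbf C_\square$ be the set of these. Walk counterclockwise around such a tree, starting at the root; write an opening parenthesis in the right corner of each $\blacklozenge$-pearl (the corner at the pearl that immediately precedes its edge on the counterclockwise walk around its vertex) and a closing parenthesis at each free $\square$-pearl, and match the parentheses of this cyclic word in the usual way. The tree is *balanced* if the closing parenthesis of the root remains unmatched, *unbalanced* otherwise; $\mathbf B_0$ and $\mathbf U_0$ denote the sets of balanced and unbalanced trees of $\mathbf C_\square$. **Statement.** (1) For every $\mathcal Q$ there is a bijection $$\mathcal F_0\sqcup\mathcal F_0^{\blacklozenge}\;\cong\;\mathbf B_0\cup\mathbf U_0=\mathbf C_\square ,\qquad \mathbf B_0\cap\mathbf U_0=\emptyset,$$ that sends $\mathcal F_0$ to $\mathbf B_0$ and $\mathcal F_0^{\blacklozenge}$ to $\mathbf U_0$ and is necklace-preserving: a tree and its image have the same multiset of necklaces. Each of $\mathcal F_0$, $\mathcal F_0^{\blacklozenge}$, $\mathbf C_\square$ has finitely many elements of each size, and the generating functions $f=\sum_{\tau\in\mathcal F_0}t^{|\tau|}$,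 $f^{\blacklozenge}=\sum_{\tau\in\mathcal F_0^{\blacklozenge}}t^{|\tau|}$, $C_\square=\sum_{\tau\in\mathbf C_\square}t^{|\tau|}$ satisfy $$f+f^{\blacklozenge}=C_\square .$$ (2) For $\mathcal Q_\lambda=\{\bullet\bullet,\blacktriangle,\blacklozenge\}$, the series $C_\square$ is the unique formal power series solution in $\mathbb Z[[t]]$ of $$C_\square\,(1-tC_\square)(1-2tC_\square)=2t^2 .$$ Put $c_n=[t^{3n-1}]\,C_\square$. A closed planar $\lambda$-term is a unary-binary tree, whose leaves are called variables, unary nodes abstractions and binary nodes applications, that admits a bijection from its abstractions to its variables mapping each abstraction to a variable in its subtree. For every $n\ge 1$ the number of closed planar $\lambda$-terms with $n$ abstractions is $\dfrac{c_n}{n+1}$. -/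

import Mathlib

open scoped PowerSeries

/-! ### Pearls, necklaces and pearl-rooted plane trees -/

/-- The three letters of the words that encode necklaces: `●`, `♦`, `▲`. -/
inductive Bead
  | disc
  | diamond
  | triangle
  deriving DecidableEq

/-- The pearls carried by vertices: the `□`-pearl and the three kinds of beads. The necklace of a
word `w₁ … w_k` is the clockwise cyclic sequence `□, w₁, …, w_k`. -/
inductive Pearl
  | square
  | bead (b : Bead)
  deriving DecidableEq

namespace Pearl

abbrev disc : Pearl := bead .disc
abbrev diamond : Pearl := bead .diamond
abbrev triangle : Pearl := bead .triangle

/-- The letter of a pearl, if it is not a `□`-pearl. -/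
def bead? : Pearl → Option Bead
  | square => none
  | bead b => some b

end Pearl

/-- The word of a vertex whose pearls are `c` in clockwise cyclic order: the letters read
clockwise, starting just after the `□`-pearl. -/
def necklaceWord (c : List Pearl) : List Bead :=
  (c.rotate (c.idxOf .square)).filterMap Pearl.bead?

/-- What hangs at the pearls of a vertex, other than the pearl from which the vertex is reached, in
clockwise order starting after that pearl. A pearl `x` is either free, or it is joined by an edge
to the pearl `y` of another vertex, whose remaining pearls in clockwise order after `y` are
described by `sub`. The description of the pearls that follow `x` on the vertex is `rest`. -/
inductive Limbs
  | nil
  | free (x : Pearl) (rest : Limbs)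
  | edge (x y : Pearl) (sub rest : Limbs)

namespace Limbs

/-- The pearls of the vertex itself (clockwise, without the one from which it is reached). -/
def row : Limbs → List Pearl
  | nil => []
  | free x rest => x :: rest.row
  | edge x _ _ rest => x :: rest.row

/-- All the pearls described: those of the vertex and those of all the vertices beyond. -/
def pearls : Limbs → List Pearl
  | nil => []
  | free x rest => x :: rest.pearls
  | edge x y sub rest => x :: y :: (sub.pearls ++ rest.pearls)

/-- The vertices beyond the current one, each given by its clockwise cyclic sequence of pearls. -/
def vertices : Limbs → List (List Pearl)
  | nil => []
  | free _ rest => rest.vertices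
  | edge _ y sub rest => (y :: sub.row) :: (sub.vertices ++ rest.vertices)

/-- The edges, each given by its two end pearls. -/
def edges : Limbs → List (Pearl × Pearl)
  | nil => []
  | free _ rest => rest.edges
  | edge x y sub rest => (x, y) :: (sub.edges ++ rest.edges)

/-- The free pearls. -/
def frees : Limbs → List Pearl
  | nil => []
  | free x rest => x :: rest.frees
  | edge _ _ sub rest => sub.frees ++ rest.frees

end Limbs

/-- A finite plane tree rooted at a pearl. The root pearl is free. The vertices carry pearls in
clockwise cyclic order, and the edges join pearls of different vertices; the colour of an edge is
determined by its two ends (`●—□` black, `♦—□` red, `♦—▲` blue). -/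
structure PearlTree where
  root : Pearl
  limbs : Limbs

namespace PearlTree

/-- All the pearls of the tree, in the order of the clockwise walk around it from the root. -/
def pearls (τ : PearlTree) : List Pearl := τ.root :: τ.limbs.pearls

/-- The vertices, each given by its clockwise cyclic sequence of pearls. -/
def vertices (τ : PearlTree) : List (List Pearl) := (τ.root :: τ.limbs.row) :: τ.limbs.vertices

/-- The size: the number of vertices. -/
def size (τ : PearlTree) : ℕ := τ.vertices.length

/-- The multiset of the necklaces of the vertices, written as words. -/
def necklaces (τ : PearlTree) : Multiset (List Bead) := ↑(τ.vertices.map necklaceWord)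

/-- Each vertex is a copy of a necklace of `Q`. -/
def HasNecklacesIn (Q : Set (List Bead)) (τ : PearlTree) : Prop :=
  ∀ c ∈ τ.vertices, c.count .square = 1 ∧ necklaceWord c ∈ Q

end PearlTree

/-! ### Non-negative `Q`-trees -/

/-- `x` and `y` are, in some order, of the kinds `a` and `b`. -/
def Joins (a b x y : Pearl) : Prop := (x = a ∧ y = b) ∨ (x = b ∧ y = a)

/-- Rooted `Q`-trees: `□`-rooted, with black edges `●—□` and red edges `♦—□`; the only free pearls
are the root and the `▲`-pearls, and all the `▲`-pearls are free. -/
def IsQTree (Q : Set (List Bead)) (τ : PearlTree) : Prop :=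
  τ.root = .square ∧ τ.HasNecklacesIn Q ∧
    (∀ e ∈ τ.limbs.edges, Joins .disc .square e.1 e.2 ∨ Joins .diamond .square e.1 e.2) ∧
    ∀ x ∈ τ.limbs.frees, x = .triangle

/-- The number of `▲`-pearls minus the number of `♦`-pearls. -/
def excess (l : List Pearl) : ℤ := (l.count .triangle : ℤ) - (l.count .diamond : ℤ)

/-- Every pearl has non-negative excess, the excess of a pearl being that of the subtree planted at
it, the pearl included. -/
def Limbs.NonNeg : Limbs → Prop
  | .nil => True
  | .free x rest => 0 ≤ excess [x] ∧ rest.NonNeg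
  | .edge x y sub rest =>
      0 ≤ excess (x :: y :: sub.pearls) ∧ 0 ≤ excess (y :: sub.pearls) ∧ sub.NonNeg ∧ rest.NonNeg

/-- Non-negative `Q`-trees. -/
def IsNonNegQTree (Q : Set (List Bead)) (τ : PearlTree) : Prop :=
  IsQTree Q τ ∧ 0 ≤ excess τ.pearls ∧ τ.limbs.NonNeg

/-- `𝓕₀`: the non-negative `Q`-trees with excess `0`. -/
def F₀ (Q : Set (List Bead)) : Set PearlTree := {τ | IsNonNegQTree Q τ ∧ excess τ.pearls = 0}

/-- `𝓕₀^♦`: the non-negative `Q`-trees with excess `0` and a marked `♦`-pearl. The mark is the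
position of the pearl in the list of all the pearls of the tree. -/
def F₀diamond (Q : Set (List Bead)) : Set (PearlTree × ℕ) :=
  {p | p.1 ∈ F₀ Q ∧ p.1.pearls[p.2]? = some .diamond}

/-! ### `Q`-companion trees -/

/-- Rooted `Q`-companion trees: pearl-rooted, with black edges `●—□` and blue edges `♦—▲`; no
`●`- or `♦`-pearl other than the root is free. -/
def IsCompanionTree (Q : Set (List Bead)) (τ : PearlTree) : Prop :=
  τ.HasNecklacesIn Q ∧
    (∀ e ∈ τ.limbs.edges, Joins .disc .square e.1 e.2 ∨ Joins .diamond .triangle e.1 e.2) ∧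
    ∀ x ∈ τ.limbs.frees, x ≠ .disc ∧ x ≠ .diamond

/-- No defects, i.e. no free `▲`-pearls other than the root. -/
def PearlTree.NoDefects (τ : PearlTree) : Prop := Pearl.triangle ∉ τ.limbs.frees

/-- `𝐂_□`: the `□`-rooted `Q`-companion trees without defects. -/
def Csquare (Q : Set (List Bead)) : Set PearlTree :=
  {τ | IsCompanionTree Q τ ∧ τ.root = .square ∧ τ.NoDefects}

/-- The half-edge grown in the corner of a free pearl for the inverse closure: outgoing (`U`) at a
`♦`-pearl, incoming (`D`) at a `□`-pearl. -/
def cornerOfFree : Pearl → List DyckStep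
  | .square => [.D]
  | .bead .diamond => [.U]
  | _ => []

/-- The outgoing half-edge grown at a pearl that carries an edge, if it is a `♦`-pearl. -/
def cornerOfLinked : Pearl → List DyckStep
  | .bead .diamond => [.U]
  | _ => []

/-- The half-edges met on the counterclockwise walk around what hangs at a vertex. At a `♦`-pearl
that carries an edge the half-edge grows in the right corner, the one that precedes the edge on
the counterclockwise walk around its vertex. Hence it is met before the walk along an edge that
leaves from a `♦`-pearl `x`, and just before the walk returns along an edge that arrived at a
`♦`-pearl `y`. -/
def Limbs.contour : Limbs → List DyckStep
  | .nil => []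
  | .free x rest => rest.contour ++ cornerOfFree x
  | .edge x y sub rest =>
      rest.contour ++ (cornerOfLinked x ++ sub.contour ++ cornerOfLinked y)

/-- The cyclic sequence of half-edges met on the counterclockwise walk around the tree, starting at
the root pearl. -/
def PearlTree.contour (τ : PearlTree) : List DyckStep := cornerOfFree τ.root ++ τ.limbs.contour

/-- In the closure of the cyclic sequence `l` of half-edges, the outgoing half-edge at position `i`
is matched to the incoming half-edge at position `j`: the half-edges met strictly between them,
on the way from `i` to `j`, are matched among themselves. -/
def ClosureMatches (l : List DyckStep) (i j : ℕ) : Prop :=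
  i < l.length ∧ ∃ (m : DyckWord) (r : List DyckStep),
    l.rotate i = .U :: (m.toList ++ .D :: r) ∧ j = (i + m.toList.length + 1) % l.length

/-- A `□`-rooted companion tree is balanced if its root (at position `0` of the contour) remains
unmatched in the inverse closure. -/
def PearlTree.Balanced (τ : PearlTree) : Prop := ∀ i, ¬ ClosureMatches τ.contour i 0

/-- `𝐁₀`: the balanced `□`-rooted `Q`-companion trees without defects. -/
def B₀ (Q : Set (List Bead)) : Set PearlTree := {τ | τ ∈ Csquare Q ∧ τ.Balanced}

/-- `𝐔₀`: the unbalanced `□`-rooted `Q`-companion trees without defects. -/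
def U₀ (Q : Set (List Bead)) : Set PearlTree := {τ | τ ∈ Csquare Q ∧ ¬ τ.Balanced}

/-! ### Generating functions -/

/-- The generating function `∑_{a ∈ S} t^{|a|}` of a class `S` with size function `|·|` (meaningful
when there are finitely many elements of each size). -/
noncomputable def genFun {α : Type} (S : Set α) (size : α → ℕ) : ℕ⟦X⟧ :=
  PowerSeries.mk fun n => {a ∈ S | size a = n}.ncard

/-! ### Planar `λ`-terms -/

/-- The set `{●●, ▲, ♦}` of necklaces. -/
def Qlambda : Set (List Bead) := {[.disc, .disc], [.triangle], [.diamond]}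

/-- Unary-binary trees: leaves are variables, unary nodes abstractions, binary nodes
applications. -/
inductive UBTree
  | var
  | abs (t : UBTree)
  | app (t u : UBTree)

namespace UBTree

/-- The subtree at an address (the list of the turns from the root), if the address is valid. -/
def subtreeAt : UBTree → List Bool → Option UBTree
  | t, [] => some t
  | abs t, false :: p => t.subtreeAt p
  | app t _, false :: p => t.subtreeAt p
  | app _ u, true :: p => u.subtreeAt p
  | _, _ => none

/-- The abstractions of `t`, as addresses. -/
def Abstractions (t : UBTree) : Set (List Bool) := {p | ∃ s, t.subtreeAt p = some (abs s)}

/-- The variables of `t`, as addresses. -/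
def Variables (t : UBTree) : Set (List Bool) := {p | t.subtreeAt p = some var}

/-- `m` maps injectively each abstraction to a variable in its subtree. -/
def IsBinding (t : UBTree) (m : t.Abstractions → t.Variables) : Prop :=
  Function.Injective m ∧ ∀ a, a.1 <+: (m a).1

/-- `t` is a closed planar `λ`-term: it admits a binding that leaves no variable free. -/
def IsClosedPlanar (t : UBTree) : Prop := ∃ m, t.IsBinding m ∧ Function.Surjective m

end UBTree

/-- The closed planar `λ`-terms with `n` abstractions. -/
def closedPlanarTerms (n : ℕ) : Set UBTree := {t | t.IsClosedPlanar ∧ t.Abstractions.ncard = n}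

/-! Read the counterclockwise walk around a tree as a word: an up step at each linked ♦, a down step
at each free □ other than the root, a marker at each free ▲. Everything in (1) is a statement about
such words, carried over to trees by rerooting along a path (`Spine`), which conjugates the word and
keeps every vertex as a cyclic sequence of pearls (`Spine.treeCycles_rev`).

For balanced trees, process a `Q`-tree from the leaves: the subtree below a ♦, already rewired, is
detached from that ♦ at its □ and attached again at its last free ▲. If its walk was `left, marker,
right`, the ♦ now sees `U, right, D, left`. Each ♦ consumes one free ▲, so the number of markers
equals the excess (`Rewire.count_none`). Non-negativity says that a ▲ is always available, and
excess 0 that no ▲ stays free. The walk stays a Dyck path with markers at height 0 only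
(`Rewire.run_walk`). Conversely, the first return after the `U` of a ♦ finds the □ to which the
subtree was attached (`Rewire.exists_left`, `Rewire.left_unique`).

For unbalanced trees, the cyclic word of a tree of `Csquare`, root included, has one more `D` than
`U` (`rise_walk`). By the cycle lemma exactly one □ is unmatched, and the tree is balanced when that
□ is the root (`balanced_iff`). Hence an unbalanced tree is a balanced tree with a marked free □
other than its root (`rerootAt_bijective`). These □ are as numerous as the ♦, so the mark can be
moved to a ♦ (`exists_placeEquiv`).

For (2), decomposing companion trees at the root gives two equations, and eliminating the series of
what hangs at a □ leaves the cubic. Closed planar terms are the trees of `F₀ Qlambda`: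
non-negativity at the ♦ is the Hall-type condition for a binding (`UBTree.isClosedPlanar_iff`). With
n abstractions the size is 3n−1 and there are n ways to mark a ♦, so each term contributes n+1 to
c_n. -/

/-! ### Words of up steps, down steps and markers -/

/-- The height reached from height `h` along a word of up steps, down steps and markers `none`, if
the word never goes below `0` and only meets markers at height `0`. -/
def run : ℕ → List (Option DyckStep) → Option ℕ
  | h, [] => some h
  | h, some .U :: l => run (h + 1) l
  | 0, some .D :: _ => none
  | h + 1, some .D :: l => run h l
  | 0, none :: l => run 0 l
  | _ + 1, none :: _ => none

/-- The number of up steps minus the number of down steps. -/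
def rise (l : List (Option DyckStep)) : ℤ := (l.count (some .U) : ℤ) - l.count (some .D)

@[simp] lemma rise_nil : rise [] = 0 := rfl

lemma rise_append (a b : List (Option DyckStep)) : rise (a ++ b) = rise a + rise b := by
  simp only [rise, List.count_append]; push_cast; ring

@[simp] lemma rise_U (l : List (Option DyckStep)) : rise (some .U :: l) = rise l + 1 := by
  simp [rise]; ring

@[simp] lemma rise_D (l : List (Option DyckStep)) : rise (some .D :: l) = rise l - 1 := by
  simp [rise]; ring

@[simp] lemma rise_none (l : List (Option DyckStep)) : rise (none :: l) = rise l := by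
  simp [rise]

lemma run_append (h : ℕ) (a b : List (Option DyckStep)) :
    run h (a ++ b) = (run h a).bind fun k => run k b := by
  induction a generalizing h with
  | nil => simp [run]
  | cons c a ih =>
    rcases c with _ | _ | _ <;> cases h <;> simp [run, ih]

lemma run_append_eq_some {h m : ℕ} {a b : List (Option DyckStep)} :
    run h (a ++ b) = some m ↔ ∃ k, run h a = some k ∧ run k b = some m := by
  rw [run_append, Option.bind_eq_some_iff]

lemma run_rise {h k : ℕ} {l : List (Option DyckStep)} (H : run h l = some k) :
    (k : ℤ) = h + rise l := by
  induction l generalizing h with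
  | nil => simp_all [run]
  | cons c l ih =>
    rcases c with _ | _ | _ <;> cases h <;> simp only [run, reduceCtorEq] at H <;>
      · have := ih H
        simp only [rise_none, rise_U, rise_D]
        push_cast at *
        linarith

/-- Without markers, a walk can be translated upwards. -/
lemma run_add {h k : ℕ} {l : List (Option DyckStep)} (hl : none ∉ l) (H : run h l = some k)
    (j : ℕ) : run (h + j) l = some (k + j) := by
  induction l generalizing h with
  | nil => simp_all [run]
  | cons c l ih =>
    rcases c with _ | _ | _
    · simp at hl
    · simp only [run] at H ⊢
      rw [show h + j + 1 = (h + 1) + j by omega]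
      exact ih (by simp_all) H
    · cases h with
      | zero => simp [run] at H
      | succ h =>
        simp only [run] at H
        rw [show h + 1 + j = (h + j) + 1 by omega]
        exact ih (by simp_all) H

lemma run_D {h m : ℕ} {l : List (Option DyckStep)} :
    run h (some .D :: l) = some m ↔ ∃ k, h = k + 1 ∧ run k l = some m := by
  cases h <;> simp [run]

/-- First passage below the starting height. -/
lemma exists_first_return {h m k : ℕ} {l : List (Option DyckStep)}
    (H : run (h + 1 + k) l = some m) (hm : m ≤ h) :
    ∃ a b, l = a ++ some .D :: b ∧ none ∉ a ∧ run k a = some 0 ∧ run h b = some m := by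
  induction l generalizing k with
  | nil => simp [run] at H; omega
  | cons c l ih =>
    rcases c with _ | _ | _
    -- The height is positive here, where no marker is allowed.
    · rw [show h + 1 + k = (h + k) + 1 by omega] at H
      simp [run] at H
    · rw [run] at H
      obtain ⟨a, b, rfl, h1, h2, h3⟩ := ih (k := k + 1) H
      exact ⟨some .U :: a, b, rfl, by simpa using h1, h2, h3⟩
    · rw [show h + 1 + k = (h + k) + 1 by omega] at H
      rw [run] at H
      cases k with
      | zero => exact ⟨[], l, rfl, by simp, rfl, H⟩
      | succ k =>
        rw [show h + (k + 1) = h + 1 + k by omega] at H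
        obtain ⟨a, b, rfl, h1, h2, h3⟩ := ih H
        exact ⟨some .D :: a, b, rfl, by simpa using h1, h2, h3⟩

/-- If one excursion strictly extended the other, it would contain a down step taken from height 0.
-/
lemma first_return_unique {a b a' b' : List (Option DyckStep)}
    (H : a ++ some .D :: b = a' ++ some .D :: b') (h : run 0 a = some 0)
    (h' : run 0 a' = some 0) : a = a' := by
  have key : ∀ {c a : List (Option DyckStep)}, run 0 a = some 0 →
      run 0 (a ++ some .D :: c) ≠ some 0 := by
    intro c a h
    simp [run_append, h, run]
  rcases List.append_eq_append_iff.1 H with ⟨c, rfl, hc⟩ | ⟨c, rfl, hc⟩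
  · cases c with
    | nil => simp
    | cons x c =>
      simp only [List.cons_append, List.cons.injEq] at hc
      rw [← hc.1] at h'
      exact (key h h').elim
  · cases c with
    | nil => simp
    | cons x c =>
      simp only [List.cons_append, List.cons.injEq] at hc
      rw [← hc.1] at h
      exact (key h' h).elim

/-- Last passage at height `j`. -/
lemma exists_last_ascent {h j : ℕ} {l : List (Option DyckStep)} (hl : none ∉ l)
    (H : run 0 l = some h) (hj : j < h) :
    ∃ a b, l = a ++ some .U :: b ∧ run 0 a = some j ∧ run 0 b = some (h - j - 1) := by
  induction l using List.reverseRecOn generalizing h with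
  | nil => simp [run] at H; omega
  | append_singleton l c ih =>
    obtain ⟨k, h1, h2⟩ := run_append_eq_some.1 H
    rcases c with _ | _ | _
    · simp at hl
    · simp only [run, Option.some.injEq] at h2
      subst h2
      by_cases hk : j = k
      · subst hk
        exact ⟨l, [], rfl, h1, by simp [run]⟩
      · obtain ⟨a, b, rfl, h3, h4⟩ := ih (by simp_all) h1 (by omega)
        refine ⟨a, b ++ [some .U], by simp, h3, ?_⟩
        rw [run_append, h4]
        simp [run]; omega
    · obtain ⟨k, rfl, h2⟩ := run_D.1 h2
      simp only [run, Option.some.injEq] at h2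
      subst h2
      obtain ⟨a, b, rfl, h3, h4⟩ := ih (by simp_all) h1 (by omega)
      refine ⟨a, b ++ [some .D], by simp, h3, ?_⟩
      rw [run_append, h4, show k + 1 - j - 1 = (k - j - 1) + 1 by omega]
      simp [run]

/-- Decomposition of a word at the first visit of its minimal height. -/
lemma exists_minimum (l : List (Option DyckStep)) (hl : none ∉ l) :
    (∃ h, run 0 l = some h) ∨ ∃ a b k h, l = a ++ some .D :: b ∧ run k a = some 0 ∧
      run 0 b = some h := by
  induction l using List.reverseRecOn with
  | nil => exact Or.inl ⟨0, rfl⟩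
  | append_singleton l c ih =>
    have hl' : none ∉ l := by simp_all
    rcases c with _ | _ | _
    · simp at hl
    · rcases ih hl' with ⟨h, H⟩ | ⟨a, b, k, h, rfl, h1, h2⟩
      · exact Or.inl ⟨h + 1, by simp [run_append, H, run]⟩
      · exact Or.inr ⟨a, b ++ [some .U], k, h + 1, by simp, h1, by simp [run_append, h2, run]⟩
    · rcases ih hl' with ⟨h, H⟩ | ⟨a, b, k, h, rfl, h1, h2⟩
      · cases h with
        | zero => exact Or.inr ⟨l, [], 0, 0, rfl, H, rfl⟩
        | succ h => exact Or.inl ⟨h, by simp [run_append, H, run]⟩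
      · cases h with
        | zero =>
          -- The final down step reaches a new strict minimum. The minimum is now one lower, so the
          -- part before it has to start one higher.
          refine Or.inr ⟨a ++ some .D :: b, [], k + 1, 0, rfl, ?_, rfl⟩
          have := run_add (by simp_all) h1 1
          simp [run_append, this, run, h2]
        | succ h =>
          exact Or.inr ⟨a, b ++ [some .D], k, h, by simp, h1, by simp [run_append, h2, run]⟩

/-- Cycle lemma, existence: a word with as many up steps as down steps that goes below `0` has a
conjugate at a down step that does not. -/
lemma exists_conjugate {l : List (Option DyckStep)} (hl : none ∉ l) (h0 : rise l = 0)
    (H : run 0 l ≠ some 0) :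
    ∃ a b, l = a ++ some .D :: b ∧ run 0 (b ++ some .D :: a) = some 0 := by
  rcases exists_minimum l hl with ⟨h, h1⟩ | ⟨a, b, k, h, rfl, h1, h2⟩
  · have := run_rise h1
    rw [h0] at this
    obtain rfl : h = 0 := by simpa using this
    exact (H h1).elim
  · refine ⟨a, b, rfl, ?_⟩
    have e1 := run_rise h1
    have e2 := run_rise h2
    rw [rise_append, rise_D] at h0
    obtain rfl : h = k + 1 := by push_cast at *; omega
    simp [run_append, h2, run, h1]

/-- Ending the first word at height 0, `a` has non-positive rise; opening the second one before a
down step, it has positive rise. -/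
lemma conjugate_ne {a b : List (Option DyckStep)} (H : run 0 (b ++ some .D :: a) = some 0) :
    run 0 (a ++ some .D :: b) ≠ some 0 := by
  intro H'
  obtain ⟨k, h1, h2⟩ := run_append_eq_some.1 H
  obtain ⟨k, rfl, h5⟩ := run_D.1 h2
  obtain ⟨j, h3, h4⟩ := run_append_eq_some.1 H'
  obtain ⟨j, rfl, h4⟩ := run_D.1 h4
  have := run_rise h5
  have := run_rise h3
  push_cast at *
  omega

/-- Cycle lemma, uniqueness. -/
lemma conjugate_unique {a b a' b' : List (Option DyckStep)}
    (E : a ++ some .D :: b = a' ++ some .D :: b')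
    (H : run 0 (b ++ some .D :: a) = some 0) (H' : run 0 (b' ++ some .D :: a') = some 0) :
    a = a' := by
  -- The factor `q` between the two cuts opens one conjugate and precedes a down step there, so its
  -- rise is positive. It closes the other conjugate, so its rise is non-positive.
  have key : ∀ {a q b' : List (Option DyckStep)},
      run 0 ((q ++ some .D :: b') ++ some .D :: a) = some 0 →
      run 0 (b' ++ some .D :: (a ++ some .D :: q)) = some 0 → False := by
    intro a q b' h h'
    rw [List.append_assoc] at h
    obtain ⟨k, h1, h2⟩ := run_append_eq_some.1 h
    obtain ⟨k, rfl, -⟩ := run_D.1 h2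
    rw [show b' ++ some .D :: (a ++ some .D :: q) = (b' ++ some .D :: (a ++ [some .D])) ++ q by simp]
      at h'
    obtain ⟨j, -, h4⟩ := run_append_eq_some.1 h'
    have := run_rise h1
    have := run_rise h4
    push_cast at *
    omega
  rcases List.append_eq_append_iff.1 E with ⟨c, rfl, hc⟩ | ⟨c, rfl, hc⟩
  · cases c with
    | nil => simp
    | cons x c =>
      simp only [List.cons_append, List.cons.injEq] at hc
      obtain ⟨rfl, rfl⟩ := hc
      exact (key H H').elim
  · cases c with
    | nil => simp
    | cons x c =>
      simp only [List.cons_append, List.cons.injEq] at hc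
      obtain ⟨rfl, rfl⟩ := hc
      exact (key H' H).elim

lemma count_map_some (l : List DyckStep) (x : DyckStep) :
    (l.map some).count (some x) = l.count x :=
  List.count_map_of_injective _ _ (Option.some_injective _) _

lemma run_of_nonneg {h : ℕ} {l : List DyckStep}
    (H : ∀ i, (l.take i).count .D ≤ h + (l.take i).count .U) :
    ∃ k, run h (l.map some) = some k := by
  induction l generalizing h with
  | nil => exact ⟨h, rfl⟩
  | cons c l ih =>
    cases c with
    | U =>
      refine ih fun i => ?_
      have := H (i + 1)
      simp at this
      omega
    | D =>
      cases h with
      | zero => simpa using H 1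
      | succ h =>
        refine ih fun i => ?_
        have := H (i + 1)
        simp at this
        omega

lemma run_dyckWord (m : DyckWord) : run 0 (m.toList.map some) = some 0 := by
  obtain ⟨k, hk⟩ := run_of_nonneg (h := 0) (l := m.toList) fun i => by
    simpa using m.count_D_le_count_U i
  have := run_rise hk
  rw [rise, count_map_some, count_map_some, m.count_U_eq_count_D] at this
  rw [hk]
  simpa using this

lemma exists_dyckWord {l : List DyckStep} (H : run 0 (l.map some) = some 0) :
    ∃ m : DyckWord, m.toList = l := by
  refine ⟨⟨l, ?_, fun i => ?_⟩, rfl⟩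
  · have := run_rise H
    rw [rise, count_map_some, count_map_some] at this
    push_cast at this
    omega
  · rw [← List.take_append_drop i l, List.map_append] at H
    obtain ⟨k, h1, -⟩ := run_append_eq_some.1 H
    have := run_rise h1
    rw [rise, count_map_some, count_map_some] at this
    push_cast at this
    omega

/-! ### Walks around limbs -/

/-- The step met at a free pearl on the counterclockwise walk: those of `cornerOfFree`, and a
marker at each free `▲`-pearl. -/
def freeSteps : Pearl → List (Option DyckStep)
  | .square => [some .D]
  | .bead .diamond => [some .U]
  | .bead .triangle => [none]
  | .bead .disc => []

/-- The step met at a linked pearl. -/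
def linkedSteps (x : Pearl) : List (Option DyckStep) := (cornerOfLinked x).map some

lemma none_notMem_linkedSteps (x : Pearl) : none ∉ linkedSteps x := by simp [linkedSteps]

namespace Limbs

/-- The contour, with the free `▲`-pearls marked. -/
def walk : Limbs → List (Option DyckStep)
  | nil => []
  | free x rest => rest.walk ++ freeSteps x
  | edge x y sub rest => rest.walk ++ (linkedSteps x ++ sub.walk ++ linkedSteps y)

/-- Juxtaposition on the same vertex. -/
def append : Limbs → Limbs → Limbs
  | nil, M => M
  | free x rest, M => free x (rest.append M)
  | edge x y sub rest, M => edge x y sub (rest.append M)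

instance : Append Limbs := ⟨append⟩

@[simp] lemma nil_append (M : Limbs) : nil ++ M = M := rfl
@[simp] lemma free_append (x : Pearl) (L M : Limbs) : free x L ++ M = free x (L ++ M) := rfl
@[simp] lemma edge_append (x y : Pearl) (S L M : Limbs) :
    edge x y S L ++ M = edge x y S (L ++ M) := rfl

/-- The other vertices, as cyclic sequences. -/
def cycles (L : Limbs) : Multiset (Cycle Pearl) :=
  ((L.vertices.map fun c : List Pearl => (c : Cycle Pearl) : List (Cycle Pearl)) :
    Multiset (Cycle Pearl))

@[simp] lemma cycles_nil : nil.cycles = 0 := rfl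
@[simp] lemma cycles_free (x : Pearl) (L : Limbs) : (free x L).cycles = L.cycles := rfl
@[simp] lemma cycles_edge (x y : Pearl) (S L : Limbs) :
    (edge x y S L).cycles = ((y :: S.row : List Pearl) : Cycle Pearl) ::ₘ (S.cycles + L.cycles) := by
  simp [cycles, vertices]

lemma card_cycles (L : Limbs) : L.cycles.card = L.vertices.length := by simp [cycles]

@[simp] lemma row_append (L M : Limbs) : (L ++ M).row = L.row ++ M.row := by
  induction L <;> simp_all [row]

@[simp] lemma walk_append (L M : Limbs) : (L ++ M).walk = M.walk ++ L.walk := by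
  induction L <;> simp_all [walk]

@[simp] lemma cycles_append (L M : Limbs) : (L ++ M).cycles = L.cycles + M.cycles := by
  induction L <;> simp_all [add_assoc]

/-- All edges satisfy `r` and all free pearls satisfy `p`. -/
def All (r : Pearl → Pearl → Prop) (p : Pearl → Prop) : Limbs → Prop
  | nil => True
  | free x rest => p x ∧ rest.All r p
  | edge x y sub rest => r x y ∧ sub.All r p ∧ rest.All r p

lemma all_iff (r : Pearl → Pearl → Prop) (p : Pearl → Prop) (L : Limbs) :
    L.All r p ↔ (∀ e ∈ L.edges, r e.1 e.2) ∧ ∀ x ∈ L.frees, p x := by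
  induction L with
  | nil => simp [All, edges, frees]
  | free x rest ih => simp only [All, ih, edges, frees, List.forall_mem_cons]; tauto
  | edge x y sub rest ih1 ih2 =>
    simp only [All, ih1, ih2, edges, frees, List.forall_mem_cons, List.forall_mem_append]; tauto

lemma all_append (r : Pearl → Pearl → Prop) (p : Pearl → Prop) (L M : Limbs) :
    (L ++ M).All r p ↔ L.All r p ∧ M.All r p := by
  induction L <;> simp_all [All, and_assoc]

end Limbs

/-! ### Spines: paths from the root vertex, and rerooting along them. -/

open Limbs

/-- The path from the vertex at the root to a vertex, with what hangs on both sides of it. -/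
inductive Spine
  | last (A B : Limbs)
  | step (A : Limbs) (a b : Pearl) (B : Limbs) (s : Spine)

namespace Spine

/-- The limbs with the given spine, `k` telling what hangs at its end. -/
def plug : Spine → (Limbs → Limbs) → Limbs
  | last A B, k => A ++ k B
  | step A a b B s, k => A ++ edge a b (s.plug k) B

/-- Adds a vertex at the far end; reversal needs it because the first vertex becomes the last one.
-/
def extend : Spine → Pearl → Pearl → Limbs → Limbs → Spine
  | last A' B', a, b, A, B => step A' a b B' (last A B)
  | step A' a' b' B' s, a, b, A, B => step A' a' b' B' (s.extend a b A B)

/-- The spine seen from its other end. -/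
def rev : Spine → Spine
  | last A B => last B A
  | step A a b B s => s.rev.extend b a B A

/-- The part of the walk before the end of the spine. -/
def left : Spine → List (Option DyckStep)
  | last _ B => B.walk
  | step _ a _ B s => B.walk ++ linkedSteps a ++ s.left

/-- The part of the walk after the end of the spine. -/
def right : Spine → List (Option DyckStep)
  | last A _ => A.walk
  | step A _ b _ s => s.right ++ linkedSteps b ++ A.walk

lemma plug_extend (s : Spine) (a b : Pearl) (A B : Limbs) (k : Limbs → Limbs) :
    (s.extend a b A B).plug k = s.plug fun R => edge a b (A ++ k B) R := by
  induction s <;> simp_all [extend, plug]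

lemma rev_extend (s : Spine) (a b : Pearl) (A B : Limbs) :
    (s.extend a b A B).rev = step B b a A s.rev := by
  induction s <;> simp_all [extend, rev]

@[simp] lemma rev_rev (s : Spine) : s.rev.rev = s := by
  induction s <;> simp_all [rev, rev_extend]

lemma left_extend (s : Spine) (a b : Pearl) (A B : Limbs) :
    (s.extend a b A B).left = s.left ++ linkedSteps a ++ B.walk := by
  induction s <;> simp_all [extend, left]

-- Seen from the other end, the two sides of the path are met in the opposite order, while each is
-- still walked in the same direction. Rerooting thus conjugates the walk.
@[simp] lemma left_rev (s : Spine) : s.rev.left = s.right := by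
  induction s <;> simp_all [rev, left_extend, left, right]

@[simp] lemma right_rev (s : Spine) : s.rev.right = s.left := by
  rw [← left_rev, rev_rev]

lemma walk_plug_free (s : Spine) (x : Pearl) :
    (s.plug (free x)).walk = s.left ++ (freeSteps x ++ s.right) := by
  induction s <;> simp_all [plug, walk, left, right]

/-- The multiset of the vertices of a tree, as cyclic sequences. -/
def _root_.treeCycles (y : Pearl) (L : Limbs) : Multiset (Cycle Pearl) :=
  ((y :: L.row : List Pearl) : Cycle Pearl) ::ₘ L.cycles

lemma row_plug_congr (s : Spine) {k k' : Limbs → Limbs} (h : ∀ R, (k R).row = (k' R).row) :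
    (s.plug k).row = (s.plug k').row := by
  cases s <;> simp_all [plug, row]

lemma cycles_plug_edge (s : Spine) (b a : Pearl) (E : Limbs) :
    (s.plug (edge b a E)).cycles = (s.plug (free b)).cycles + treeCycles a E := by
  induction s with
  | last A B =>
    simp only [plug, cycles_append, cycles_edge, cycles_free, treeCycles, ← Multiset.singleton_add]
    abel
  | step A a' b' B s ih =>
    simp only [plug, cycles_append, cycles_edge, ih]
    rw [s.row_plug_congr (k := edge b a E) (k' := free b) fun R => rfl]
    simp only [treeCycles, ← Multiset.singleton_add]
    abel

/-- Rerooting preserves the vertices. -/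
lemma treeCycles_rev (s : Spine) (x y : Pearl) :
    treeCycles x (s.rev.plug (free y)) = treeCycles y (s.plug (free x)) := by
  induction s generalizing x y with
  | last A B =>
    have : ((x :: (B.row ++ y :: A.row) : List Pearl) : Cycle Pearl) =
        ((y :: (A.row ++ x :: B.row) : List Pearl) : Cycle Pearl) :=
      Cycle.coe_eq_coe.2 (List.isRotated_append (l := x :: B.row) (l' := y :: A.row))
    simp only [treeCycles, rev, plug, row_append, row, cycles_append, cycles_free, this, add_comm]
  | step A a b B s ih =>
    -- After reversal the old root vertex hangs at the far end, behind the edge `b`–`a`. Splitting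
    -- it off leaves a tree to which the induction hypothesis applies.
    have e : treeCycles x (s.rev.plug (edge b a (B ++ free y A))) =
        treeCycles x (s.rev.plug (free b)) + treeCycles a (B ++ free y A) := by
      rw [treeCycles, cycles_plug_edge,
        s.rev.row_plug_congr (k := edge b a (B ++ free y A)) (k' := free b) fun R => rfl]
      simp [treeCycles, Multiset.cons_swap]
    have : ((a :: (B.row ++ y :: A.row) : List Pearl) : Cycle Pearl) =
        ((y :: (A.row ++ a :: B.row) : List Pearl) : Cycle Pearl) :=
      Cycle.coe_eq_coe.2 (List.isRotated_append (l := a :: B.row) (l' := y :: A.row))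
    rw [rev, plug_extend]
    have e' : (fun R => edge b a (B ++ free y A) R) = edge b a (B ++ free y A) := rfl
    rw [e', e, ih]
    simp only [treeCycles, plug, row_append, row, cycles_append, cycles_free, cycles_edge, this,
      ← Multiset.singleton_add]
    abel

/-- All edges and free pearls beside the spine satisfy `r` and `p`. -/
def All (r : Pearl → Pearl → Prop) (p : Pearl → Prop) : Spine → Prop
  | last A B => A.All r p ∧ B.All r p
  | step A a b B s => A.All r p ∧ B.All r p ∧ r a b ∧ s.All r p

lemma all_plug (r : Pearl → Pearl → Prop) (p : Pearl → Prop) (s : Spine) (x : Pearl) :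
    (s.plug (free x)).All r p ↔ s.All r p ∧ p x := by
  induction s with
  | last A B => simp only [plug, all_append, Limbs.All, All]; tauto
  | step A a b B s ih => simp only [plug, all_append, Limbs.All, All, ih]; tauto

lemma all_extend (r : Pearl → Pearl → Prop) (p : Pearl → Prop) (s : Spine) (a b : Pearl)
    (A B : Limbs) :
    (s.extend a b A B).All r p ↔ s.All r p ∧ r a b ∧ A.All r p ∧ B.All r p := by
  induction s with
  | last A B => simp only [extend, All]; tauto
  | step A a b B s ih => simp only [extend, All, ih]; tauto

lemma all_rev {r : Pearl → Pearl → Prop} (hr : ∀ x y, r x y → r y x) (p : Pearl → Prop)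
    (s : Spine) : s.rev.All r p ↔ s.All r p := by
  have hr' : ∀ x y, r x y ↔ r y x := fun x y => ⟨hr x y, hr y x⟩
  induction s with
  | last A B => simp only [rev, All]; tauto
  | step A a b B s ih => simp only [rev, all_extend, All, ih, hr' a b]; tauto

/-- Juxtaposition of limbs on the left of the first vertex. -/
def prepend (M : Limbs) : Spine → Spine
  | last A B => last (M ++ A) B
  | step A a b B s => step (M ++ A) a b B s

end Spine

/-! ### Free pearls located by their position on the walk. -/

namespace Limbs

/-- The free pearl met at position `n` of the walk, with its spine. -/
def find : Limbs → ℕ → Option (Spine × Pearl)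
  | nil, _ => none
  | free x rest, n =>
    if n < rest.walk.length then (rest.find n).map (Prod.map (Spine.prepend (free x nil)) id)
    else some (.last nil rest, x)
  | edge x y sub rest, n =>
    if n < rest.walk.length then
      (rest.find n).map (Prod.map (Spine.prepend (edge x y sub nil)) id)
    -- Positions on the up steps of `x` and `y` also return something, as do positions past the end;
    -- these values play no role, since only the positions of free pearls are looked up.
    else (sub.find (n - rest.walk.length - (linkedSteps x).length)).map
      (Prod.map (Spine.step nil x y rest) id)

end Limbs

namespace Spine

/-- Limbs are listed clockwise and walked counterclockwise, so `M` is met after `L` and shifts no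
position in it. -/
lemma find_append {M L : Limbs} {n : ℕ} {s : Spine} {x : Pearl} (hn : n < L.walk.length)
    (h : L.find n = some (s, x)) : (M ++ L).find n = some (s.prepend M, x) := by
  induction M with
  | nil => cases s <;> exact h
  | free z M ih =>
    rw [free_append, find, if_pos (by simp; omega), ih]
    cases s <;> rfl
  | edge z z' S M _ ih =>
    rw [edge_append, find, if_pos (by simp; omega), ih]
    cases s <;> rfl

lemma append_nil (L : Limbs) : L ++ nil = L := by
  induction L <;> simp_all

lemma find_plug (s : Spine) {x : Pearl} (hx : freeSteps x ≠ []) :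
    (s.plug (free x)).find s.left.length = some (s, x) := by
  have hx' := List.length_pos_iff.2 hx
  induction s with
  | last A B =>
    have : (free x B).find B.walk.length = some (.last nil B, x) := by simp [find]
    have := find_append (M := A) (by simp [walk]; omega) this
    simpa [plug, left, prepend, append_nil] using this
  | step A a b B s ih =>
    have : (edge a b (s.plug (free x)) B).find (step A a b B s).left.length =
        some (.step nil a b B s, x) := by
      rw [find, if_neg (by simp [left])]
      rw [show (step A a b B s).left.length - B.walk.length - (linkedSteps a).length =
        s.left.length by simp [left], ih]
      rfl
    have := find_append (M := A) (by simp [walk, walk_plug_free, left]; omega) this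
    simpa [plug, prepend, append_nil] using this

/-- A free pearl that is seen on the walk is determined by its place there. -/
lemma plug_inj {s s' : Spine} {x x' : Pearl} (hx : freeSteps x ≠ []) (hx' : freeSteps x' ≠ [])
    (h : s.plug (free x) = s'.plug (free x')) (hl : s.left.length = s'.left.length) :
    s = s' ∧ x = x' := by
  have := find_plug s hx
  rw [h, hl, find_plug s' hx'] at this
  simp_all

lemma prepend_plug (M : Limbs) (s : Spine) (k : Limbs → Limbs) :
    (s.prepend M).plug k = M ++ s.plug k := by
  have assoc : ∀ L : Limbs, ∀ N P : Limbs, (L ++ N) ++ P = L ++ (N ++ P) := by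
    intro L N P
    induction L <;> simp_all
  cases s <;> simp [prepend, plug, assoc]

lemma left_prepend (M : Limbs) (s : Spine) : (s.prepend M).left = s.left := by
  cases s <;> rfl

/-- Each down step or marker on the walk is met at a free pearl. -/
lemma exists_plug {L : Limbs} {l r : List (Option DyckStep)} {d : Option DyckStep}
    (hd : d ≠ some .U) (h : L.walk = l ++ d :: r) :
    ∃ (s : Spine) (x : Pearl), L = s.plug (free x) ∧ freeSteps x = [d] ∧ s.left = l ∧
      s.right = r := by
  suffices H : ∀ (L : Limbs) (l r : List (Option DyckStep)), L.walk = l ++ d :: r →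
      ∃ (s : Spine) (x : Pearl), L = s.plug (free x) ∧ freeSteps x = [d] ∧ s.left = l by
    obtain ⟨s, x, rfl, h2, rfl⟩ := H L l r h
    refine ⟨s, x, rfl, h2, rfl, ?_⟩
    rw [walk_plug_free, h2] at h
    simpa using h
  intro L
  have single : ∀ x : Pearl, freeSteps x = [] ∨ ∃ e, freeSteps x = [e] := by
    rintro (_ | _ | _ | _) <;> simp [freeSteps]
  -- Linked pearls produce only up steps, so the step `d` cannot come from them.
  have linked : ∀ x : Pearl, linkedSteps x = [] ∨ linkedSteps x = [some .U] := by
    rintro (_ | _ | _ | _) <;> simp [linkedSteps, cornerOfLinked]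
  induction L with
  | nil => simp [walk]
  | free z rest ih =>
    intro l r h
    rw [walk] at h
    rcases List.append_eq_append_iff.1 h with ⟨c, rfl, hc⟩ | ⟨c, hc, hc'⟩
    · obtain e | ⟨e, he⟩ := single z
      · simp [e] at hc
      · rw [he] at hc
        obtain rfl : c = [] := by
          cases c with
          | nil => rfl
          | cons _ c => simp at hc
        simp only [List.nil_append, List.cons.injEq] at hc
        exact ⟨.last nil rest, z, rfl, by rw [he, hc.1], by simp [left]⟩
    · cases c with
      | nil =>
        obtain e | ⟨e, he⟩ := single z
        · simp [e] at hc'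
        · simp only [he, List.nil_append, List.cons.injEq] at hc'
          refine ⟨.last nil rest, z, rfl, by rw [he, hc'.1], by simp [left, hc]⟩
      | cons e c =>
        simp only [List.cons_append, List.cons.injEq] at hc'
        obtain ⟨rfl, -⟩ := hc'
        obtain ⟨s, x, rfl, h2, h3⟩ := ih _ _ hc
        exact ⟨s.prepend (free z nil), x, by simp [prepend_plug], h2, by rw [left_prepend, h3]⟩
  | edge z z' S rest ih1 ih2 =>
    intro l r h
    rw [walk] at h
    have sub : ∀ l', linkedSteps z ++ S.walk ++ linkedSteps z' = l' ++ d :: r →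
        ∃ (s : Spine) (x : Pearl), edge z z' S rest = s.plug (free x) ∧ freeSteps x = [d] ∧
          s.left = rest.walk ++ l' := by
      intro l' h'
      have : ∃ l'' r'', l' = linkedSteps z ++ l'' ∧ S.walk = l'' ++ d :: r'' := by
        have : ∃ l'', l' = linkedSteps z ++ l'' ∧ S.walk ++ linkedSteps z' = l'' ++ d :: r := by
          rcases linked z with e | e
          · exact ⟨l', by simp [e], by simpa [e] using h'⟩
          · rw [e] at h' ⊢
            cases l' with
            | nil => simp at h'; exact (hd h'.1.symm).elim
            | cons u l' => exact ⟨l', by simp_all⟩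
        obtain ⟨l'', rfl, h2⟩ := this
        rcases linked z' with e | e
        · exact ⟨l'', r, rfl, by simpa [e] using h2⟩
        · rw [e] at h2
          rcases List.eq_nil_or_concat r with rfl | ⟨r, u, rfl⟩
          · have := List.append_inj_right' h2 rfl
            simp only [List.cons.injEq] at this
            exact (hd this.1.symm).elim
          · refine ⟨l'', r, rfl, List.append_inj_left' (t₁ := [some .U]) (t₂ := [u]) ?_ rfl⟩
            simpa using h2
      obtain ⟨l'', r'', rfl, h2⟩ := this
      obtain ⟨s, x, rfl, h3, h4⟩ := ih1 _ _ h2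
      exact ⟨.step nil z z' rest s, x, rfl, h3, by simp [left, h4]⟩
    rcases List.append_eq_append_iff.1 h with ⟨c, rfl, hc⟩ | ⟨c, hc, hc'⟩
    · obtain ⟨s, x, h1, h2, h3⟩ := sub _ hc
      exact ⟨s, x, h1, h2, h3⟩
    · cases c with
      | nil =>
        obtain ⟨s, x, h1, h2, h3⟩ := sub [] (by simpa using hc'.symm)
        exact ⟨s, x, h1, h2, by rw [h3, hc]; simp⟩
      | cons e c =>
        simp only [List.cons_append, List.cons.injEq] at hc'
        obtain ⟨rfl, -⟩ := hc'
        obtain ⟨s, x, rfl, h2, h3⟩ := ih2 _ _ hc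
        exact ⟨s.prepend (edge z z' S nil), x, by simp [prepend_plug], h2,
          by rw [left_prepend, h3]⟩

end Spine

/-! ### Rewiring non-negative trees into balanced companion trees -/

/-- The edges of `Q`-trees. -/
def QEdge (x y : Pearl) : Prop := Joins .disc .square x y ∨ Joins .diamond .square x y

/-- The edges of companion trees. -/
def CEdge (x y : Pearl) : Prop := Joins .disc .square x y ∨ Joins .diamond .triangle x y

/-- The pearls that may be free in companion trees. -/
def CFree (x : Pearl) : Prop := x ≠ .disc ∧ x ≠ .diamond

lemma CEdge.symm (x y : Pearl) (h : CEdge x y) : CEdge y x := by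
  unfold CEdge Joins at *; tauto

/-! ### One □ per vertex, and the balance of up and down steps. -/

/-- Each cyclic sequence has exactly one `□`-pearl. -/
def OneSquare (m : Multiset (Cycle Pearl)) : Prop :=
  ∀ c ∈ m, c.toMultiset.count .square = 1

lemma oneSquare_add {m m' : Multiset (Cycle Pearl)} :
    OneSquare (m + m') ↔ OneSquare m ∧ OneSquare m' := by
  simp only [OneSquare, Multiset.mem_add, or_imp, forall_and]

lemma oneSquare_cons {l : List Pearl} {m : Multiset (Cycle Pearl)} :
    OneSquare ((l : Cycle Pearl) ::ₘ m) ↔ l.count .square = 1 ∧ OneSquare m := by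
  simp [OneSquare]

lemma oneSquare_treeCycles {y : Pearl} {L : Limbs} :
    OneSquare (treeCycles y L) ↔ (y :: L.row).count .square = 1 ∧ OneSquare L.cycles :=
  oneSquare_cons

lemma oneSquare_treeCycles_square {L : Limbs} :
    OneSquare (treeCycles .square L) ↔ .square ∉ L.row ∧ OneSquare L.cycles := by
  rw [oneSquare_treeCycles]
  simp [List.count_eq_zero]

lemma oneSquare_edge {x y : Pearl} {S L : Limbs} :
    OneSquare (edge x y S L).cycles ↔ OneSquare (treeCycles y S) ∧ OneSquare L.cycles := by
  rw [cycles_edge, oneSquare_cons, oneSquare_treeCycles, oneSquare_add, and_assoc]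

/-- Linked to the rest of the tree by a non-`□`-pearl, limbs of companion trees have as many
`♦`-pearls as free `□`-pearls, up to the `□`-pearls of the first vertex. -/
lemma rise_walk {L : Limbs} (h : L.All CEdge CFree) (h1 : OneSquare L.cycles) :
    rise L.walk = -(L.row.count .square : ℤ) := by
  induction L with
  | nil => rfl
  | free x rest ih =>
    have := ih h.2 h1
    rcases x with _ | _ | _ | _ <;>
      simp_all [walk, row, rise_append, freeSteps, CFree, Limbs.All]
    ring
  | edge x y S rest ih1 ih2 =>
    rw [oneSquare_edge, oneSquare_treeCycles] at h1
    have e1 := ih1 h.2.1 h1.1.2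
    have e2 := ih2 h.2.2 h1.2
    have e3 := h1.1.1
    -- The walk of the subtree has rise 0 if the subtree is reached at its □, and −1 otherwise. In
    -- the latter case the −1 is cancelled by the up step of the ♦ end, or accounted for by `x`
    -- being a □ of the row.
    rcases h.1 with (⟨rfl, rfl⟩ | ⟨rfl, rfl⟩) | (⟨rfl, rfl⟩ | ⟨rfl, rfl⟩) <;>
      simp_all [walk, row, rise_append, linkedSteps, cornerOfLinked]
    ring

lemma excess_append (a b : List Pearl) : excess (a ++ b) = excess a + excess b := by
  simp only [excess, List.count_append]; push_cast; ring

lemma excess_cons (x : Pearl) (l : List Pearl) : excess (x :: l) = excess [x] + excess l := by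
  rw [← excess_append]; rfl

lemma excess_cons_cons (x y : Pearl) (l : List Pearl) :
    excess (x :: y :: l) = excess [x] + excess [y] + excess l := by
  rw [excess_cons, excess_cons y, add_assoc]

/-- `Rewire L L'`: the limbs `L'` of a companion tree are obtained from the limbs `L` of a `Q`-tree
by linking each `♦`-pearl to the last free `▲`-pearl on the walk around the subtree that hangs at
it, instead of the `□`-pearl of that subtree, from the leaves towards the root. -/
inductive Rewire : Limbs → Limbs → Prop
  | nil : Rewire nil nil
  | free {L L'} : Rewire L L' → Rewire (free .triangle L) (free .triangle L')
  | disc {S S' L L'} : Rewire S S' → Rewire L L' →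
      Rewire (edge .disc .square S L) (edge .disc .square S' L')
  | diamond {S S' R L L'} (s : Spine) : Rewire S S' → S' = s.plug (Limbs.free .triangle) →
      none ∉ s.right → R = s.rev.plug (Limbs.free .square) → Rewire L L' →
      Rewire (edge .diamond .square S L) (edge .diamond .triangle R L')

namespace Rewire

variable {L L' M : Limbs}

lemma row_eq (h : Rewire L L') : L'.row = L.row := by
  induction h <;> simp_all [row]

lemma cycles_eq (h : Rewire L L') : L'.cycles = L.cycles := by
  induction h with
  | nil => rfl
  | free _ ih => simpa using ih
  | disc h _ ih1 ih2 => simp [ih1, ih2, h.row_eq]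
  | diamond s h hs _ hR _ ih1 ih2 =>
    subst hs hR
    have := s.treeCycles_rev .triangle .square
    simp only [treeCycles] at this
    rw [cycles_edge, cycles_edge, ← Multiset.cons_add, this, h.row_eq, ih1, ih2, Multiset.cons_add]

lemma treeCycles_eq (h : Rewire L L') (y : Pearl) : treeCycles y L' = treeCycles y L := by
  rw [treeCycles, h.row_eq, h.cycles_eq, treeCycles]

lemma all_left (h : Rewire L L') : L.All QEdge (· = .triangle) := by
  induction h <;> simp_all [Limbs.All, QEdge, Joins]

lemma all_right (h : Rewire L L') : L'.All CEdge CFree := by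
  induction h with
  | nil => trivial
  | free _ ih => exact ⟨by simp [CFree], ih⟩
  | disc _ _ ih1 ih2 => exact ⟨by simp [CEdge, Joins], ih1, ih2⟩
  | diamond s h hs _ hR _ ih1 ih2 =>
    subst hs hR
    rw [Spine.all_plug] at ih1
    refine ⟨by simp [CEdge, Joins], ?_, ih2⟩
    rw [Spine.all_plug, Spine.all_rev CEdge.symm]
    exact ⟨ih1.1, by simp [CFree]⟩

lemma run_none {h m : ℕ} {l : List (Option DyckStep)} :
    run h (none :: l) = some m ↔ h = 0 ∧ run 0 l = some m := by
  cases h <;> simp [run]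

/-- Both sides of the chosen marker are walks from 0 to 0. The right one moves under the new up
step, at height 1, which is allowed because the chosen ▲ is the last and leaves no marker there. -/
lemma run_walk (h : Rewire L L') : run 0 L'.walk = some 0 := by
  induction h with
  | nil => rfl
  | free _ ih => simp [walk, freeSteps, run_append, ih, run]
  | disc _ _ ih1 ih2 =>
    simp [walk, linkedSteps, cornerOfLinked, run_append, ih1, ih2]
  | diamond s h hs hn hR _ ih1 ih2 =>
    subst hs hR
    rw [Spine.walk_plug_free] at ih1
    obtain ⟨k, h1, h2⟩ := run_append_eq_some.1 ih1
    obtain ⟨rfl, h2⟩ := run_none.1 h2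
    have := run_add hn h2 1
    simp [walk, linkedSteps, cornerOfLinked, run_append, ih2, run, Spine.walk_plug_free, this,
      freeSteps, h1]

/-- Each ♦ uses up exactly one free ▲; what is left over is the excess. -/
lemma count_none (h : Rewire L L') : (L'.walk.count none : ℤ) = excess L.pearls := by
  have hl : ∀ x, (linkedSteps x).count none = 0 := fun x =>
    List.count_eq_zero.2 (none_notMem_linkedSteps x)
  induction h with
  | nil => rfl
  | free _ ih =>
    rw [pearls, excess_cons, ← ih, walk, List.count_append]
    simp [freeSteps, excess]; ring
  | disc _ _ ih1 ih2 =>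
    rw [pearls, excess_cons_cons, excess_append, ← ih1, ← ih2, walk]
    simp [hl, excess]; ring
  | diamond s h hs hn hR _ ih1 ih2 =>
    subst hs hR
    rw [pearls, excess_cons_cons, excess_append, ← ih1, ← ih2, walk]
    simp [hl, excess, Spine.walk_plug_free, freeSteps]; ring

/-- By `count_none` the excess of a rewired part is a number of markers; below a ♦ it is at least 1,
since a marker was there to be linked. -/
lemma nonneg (h : Rewire L L') : L.NonNeg := by
  induction h with
  | nil => trivial
  | free _ ih => exact ⟨by simp [excess], ih⟩
  | disc h _ ih1 ih2 =>
    have := h.count_none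
    refine ⟨?_, ?_, ih1, ih2⟩
    · rw [excess_cons_cons, ← this]; simp [excess]
    · rw [excess_cons, ← this]; simp [excess]
  | diamond s h hs hn hR _ ih1 ih2 =>
    have := h.count_none
    subst hs
    rw [Spine.walk_plug_free] at this
    refine ⟨?_, ?_, ih1, ih2⟩
    · rw [excess_cons_cons, ← this]; simp [excess, freeSteps]; omega
    · rw [excess_cons, ← this]; simp [excess]; positivity

/-- `none ∉ s.right` forces the chosen ▲ to be the last marker, and a free pearl seen on the walk is
determined by its place. -/
lemma right_unique (h : Rewire L L') (h' : Rewire L M) : L' = M := by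
  induction h generalizing M with
  | nil => cases h'; rfl
  | free _ ih => cases h' with | free h' => rw [ih h']
  | disc _ _ ih1 ih2 => cases h' with | disc h1 h2 => rw [ih1 h1, ih2 h2]
  | diamond s h hs hn hR _ ih1 ih2 =>
    cases h' with
    | diamond t h1 ht hm hR' h2 =>
      have e := ih1 h1
      subst hs hR hR' ht
      have e' := congrArg walk e
      rw [Spine.walk_plug_free, Spine.walk_plug_free] at e'
      have : s.right.length = t.right.length := by
        have key : ∀ {l r l' r' : List (Option DyckStep)}, l ++ none :: r = l' ++ none :: r' →
            none ∉ r → r.length ≤ r'.length := by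
          intro l r l' r' h1 h2
          rcases List.append_eq_append_iff.1 h1 with ⟨c, -, hc⟩ | ⟨c, -, hc⟩
          · cases c with
            | nil => simp at hc; rw [hc]
            | cons u c => simp at hc; simp [hc.2] at h2
          · cases c with
            | nil => simp at hc; rw [hc]
            | cons u c => simp at hc; simp [hc.2]; omega
        exact le_antisymm (key e' hn) (key e'.symm hm)
      have hlen := congrArg List.length e'
      obtain ⟨rfl, -⟩ := Spine.plug_inj (by simp [freeSteps]) (by simp [freeSteps]) e
        (by simp [freeSteps] at hlen; omega)
      rw [ih2 h2]

/-- The freed □ is the first return after the up step of the ♦, so `L'` determines the path along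
which the subtree was rerooted. -/
lemma left_unique (h : Rewire L L') (h' : Rewire M L') : L = M := by
  induction h generalizing M with
  | nil => cases h'; rfl
  | free _ ih => cases h' with | free h' => rw [ih h']
  | disc _ _ ih1 ih2 => cases h' with | disc h1 h2 => rw [ih1 h1, ih2 h2]
  | diamond s h hs hn hR _ ih1 ih2 =>
    cases h' with
    | diamond t h1 ht hm hR' h2 =>
      subst hs hR ht
      have r1 := h.run_walk
      have r2 := h1.run_walk
      have e' := congrArg walk hR'
      simp only [Spine.walk_plug_free, Spine.left_rev, Spine.right_rev, freeSteps] at e' r1 r2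
      have : s.right = t.right := by
        obtain ⟨k, -, h3⟩ := run_append_eq_some.1 r1
        obtain ⟨k, -, h4⟩ := run_append_eq_some.1 r2
        exact first_return_unique e' (run_none.1 h3).2 (run_none.1 h4).2
      obtain ⟨e, -⟩ := Spine.plug_inj (by simp [freeSteps]) (by simp [freeSteps]) hR'
        (by simp [this])
      have : s = t := by rw [← s.rev_rev, e, t.rev_rev]
      subst this
      rw [ih1 h1, ih2 h2]

lemma square_of_freeSteps {x : Pearl} (h : freeSteps x = [some .D]) : x = .square := by
  rcases x with _ | _ | _ | _ <;> simp_all [freeSteps]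

lemma triangle_of_freeSteps {x : Pearl} (h : freeSteps x = [none]) : x = .triangle := by
  rcases x with _ | _ | _ | _ <;> simp_all [freeSteps]

theorem exists_right (h : L.All QEdge (· = .triangle)) (h1 : OneSquare L.cycles)
    (hrow : .square ∉ L.row) (hL : L.NonNeg) : ∃ L', Rewire L L' := by
  induction L with
  | nil => exact ⟨_, .nil⟩
  | free x rest ih =>
    obtain ⟨rfl, h⟩ := h
    obtain ⟨L', hL'⟩ := ih h h1 (by simp_all [row]) hL.2
    exact ⟨_, .free hL'⟩
  | edge x y S rest ih1 ih2 =>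
    rw [oneSquare_edge] at h1
    obtain ⟨L', hL'⟩ := ih2 h.2.2 h1.2 (by simp_all [row]) hL.2.2.2
    have hsub : y = .square → ∃ S', Rewire S S' := by
      rintro rfl
      rw [oneSquare_treeCycles_square] at h1
      exact ih1 h.2.1 h1.1.2 h1.1.1 hL.2.2.1
    rcases h.1 with (⟨rfl, rfl⟩ | ⟨rfl, rfl⟩) | (⟨rfl, rfl⟩ | ⟨rfl, rfl⟩)
    · obtain ⟨S', hS'⟩ := hsub rfl
      exact ⟨_, .disc hS' hL'⟩
    · simp [row] at hrow
    -- Non-negative excess at the ♦ itself means that the rewired subtree still has a free ▲. Its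
    -- last one is found by searching the reversed walk.
    · obtain ⟨S', hS'⟩ := hsub rfl
      have hpos : none ∈ S'.walk := by
        rw [← List.count_pos_iff]
        have e := hL.1
        rw [excess_cons_cons, ← hS'.count_none] at e
        simp [excess] at e
        simpa [← List.count_pos_iff] using e
      obtain ⟨r, l, e, hr⟩ := List.eq_append_cons_of_mem (List.mem_reverse.2 hpos)
      rw [List.reverse_eq_iff, List.reverse_append, List.reverse_cons, List.append_assoc] at e
      obtain ⟨s, x, hs, hx, -, hright⟩ := Spine.exists_plug (by simp) e
      obtain rfl := triangle_of_freeSteps hx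
      exact ⟨_, .diamond s hS' hs (by simpa [hright] using hr) rfl hL'⟩
    · simp [row] at hrow

/-- Undoing a link ♦–▲ reroots the subtree, which is then no longer a structural part of `L'`; hence
the outer induction on the number of vertices. -/
theorem exists_left (h : L'.All CEdge CFree) (h1 : OneSquare L'.cycles)
    (hrow : .square ∉ L'.row) (hr : run 0 L'.walk = some 0) : ∃ L, Rewire L L' := by
  suffices H : ∀ n, ∀ L' : Limbs, L'.cycles.card ≤ n → L'.All CEdge CFree → OneSquare L'.cycles →
      .square ∉ L'.row → run 0 L'.walk = some 0 → ∃ L, Rewire L L' from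
    H _ L' le_rfl h h1 hrow hr
  clear! L'
  -- Each limb has rise 0, so the walk is back at height 0 between consecutive limbs and each can be
  -- treated alone.
  have split : ∀ {a b : List (Option DyckStep)}, run 0 (a ++ b) = some 0 → rise a = 0 →
      run 0 a = some 0 ∧ run 0 b = some 0 := by
    intro a b h ha
    obtain ⟨k, h1, h2⟩ := run_append_eq_some.1 h
    have := run_rise h1
    obtain rfl : k = 0 := by omega
    exact ⟨h1, h2⟩
  intro n
  induction n using Nat.strong_induction_on with
  | _ n IH =>
  intro L'
  induction L' with
  | nil => exact fun _ _ _ _ _ => ⟨_, .nil⟩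
  | free x rest ih =>
    intro hn h h1 hrow hr
    have hrow' : .square ∉ rest.row := by simp_all [row]
    have hrise := rise_walk h.2 h1
    rw [List.count_eq_zero.2 hrow'] at hrise
    obtain ⟨hr, -⟩ := split hr (by simpa using hrise)
    obtain ⟨L, hL⟩ := ih hn h.2 h1 hrow' hr
    rcases x with _ | _ | _ | _
    · simp [row] at hrow
    · exact (h.1.1 rfl).elim
    · exact (h.1.2 rfl).elim
    · exact ⟨_, .free hL⟩
  | edge x y S rest ih1 ih2 =>
    intro hn h h1 hrow hr
    rw [oneSquare_edge] at h1
    have hrow' : .square ∉ rest.row := by simp_all [row]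
    have hrise := rise_walk h.2.2 h1.2
    rw [List.count_eq_zero.2 hrow'] at hrise
    obtain ⟨hr, hr'⟩ := split hr (by simpa using hrise)
    have hn' := hn
    rw [cycles_edge, Multiset.card_cons, Multiset.card_add] at hn'
    obtain ⟨L, hL⟩ := ih2 (by omega) h.2.2 h1.2 hrow' hr
    rcases h.1 with (⟨rfl, rfl⟩ | ⟨rfl, rfl⟩) | (⟨rfl, rfl⟩ | ⟨rfl, rfl⟩)
    · rw [oneSquare_treeCycles_square] at h1
      obtain ⟨M, hM⟩ := ih1 (by omega) h.2.1 h1.1.2 h1.1.1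
        (by simpa [linkedSteps, cornerOfLinked] using hr')
      exact ⟨_, .disc hM hL⟩
    · simp [row] at hrow
    · have hS : rise S.walk = -1 := by
        rw [oneSquare_treeCycles] at h1
        have := h1.1.1
        rw [rise_walk h.2.1 h1.1.2]
        simpa using this
      simp only [linkedSteps, cornerOfLinked, List.map_cons, List.map_nil, List.append_nil,
        List.singleton_append, run] at hr'
      -- The down step matched with the up step of this ♦ is met at the □ to be linked back to it.
      obtain ⟨a, b, e, ha, ha0, hb⟩ := exists_first_return (h := 0) (k := 0) (m := 0) hr' le_rfl
      obtain ⟨t, x, rfl, hx, rfl, rfl⟩ := Spine.exists_plug (by simp) e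
      obtain rfl := square_of_freeSteps hx
      have hc := t.treeCycles_rev .square .triangle
      have hcard := congrArg Multiset.card hc
      simp only [treeCycles, Multiset.card_cons] at hcard
      have h1' := h1.1
      rw [← hc, oneSquare_treeCycles_square] at h1'
      obtain ⟨M, hM⟩ := IH _ (by omega) (t.rev.plug (Limbs.free .triangle)) le_rfl
        (by
          have := h.2.1
          rw [Spine.all_plug] at this ⊢
          rw [Spine.all_rev CEdge.symm]
          exact ⟨this.1, by simp [CFree]⟩) h1'.2 h1'.1
        (by simp [Spine.walk_plug_free, run_append, freeSteps, hb, ha0, run])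
      exact ⟨_, .diamond t.rev hM rfl (by simpa using ha) (by simp) hL⟩
    -- An edge from a ▲ to a ♦ puts the up step after the walk around the subtree, which would
    -- descend from 0 to −1 first.
    · have hS : rise S.walk = -1 := by
        rw [oneSquare_treeCycles] at h1
        have := h1.1.1
        rw [rise_walk h.2.1 h1.1.2]
        simpa using this
      simp only [linkedSteps, cornerOfLinked, List.map_nil, List.nil_append] at hr'
      obtain ⟨k, h2, -⟩ := run_append_eq_some.1 hr'
      have := run_rise h2
      omega

end Rewire

/-! ### Necklaces as cyclic words -/

lemma necklaceWord_split {A B : List Pearl} (h : .square ∉ A) :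
    necklaceWord (A ++ .square :: B) = (B ++ A).filterMap Pearl.bead? := by
  have : (A ++ .square :: B).idxOf Pearl.square = A.length := by
    rw [List.idxOf_append_of_notMem h]; simp
  rw [necklaceWord, this, List.rotate_append_length_eq]
  rfl

/-- Reading starts at the □; as it is unique, the place where the cycle is cut is irrelevant. -/
lemma necklaceWord_rotate_one {l : List Pearl} (h : l.count .square = 1) :
    necklaceWord (l.rotate 1) = necklaceWord l := by
  cases l with
  | nil => rfl
  | cons x t =>
    rw [List.rotate_cons_succ, List.rotate_zero]
    by_cases hx : x = .square
    · subst hx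
      have ht : .square ∉ t := by simpa [List.count_eq_zero] using h
      rw [necklaceWord_split ht]
      have := necklaceWord_split (A := []) (B := t) (by simp)
      simp only [List.nil_append] at this
      rw [this]; simp
    · have ht : .square ∈ t := by
        rw [← List.count_pos_iff]
        rw [List.count_cons_of_ne hx] at h
        omega
      obtain ⟨A, B, rfl, hA⟩ := List.eq_append_cons_of_mem ht
      have e1 := necklaceWord_split (A := A) (B := B ++ [x]) hA
      have e2 := necklaceWord_split (A := x :: A) (B := B) (by
        simp only [List.mem_cons, not_or]; exact ⟨fun h => hx h.symm, hA⟩)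
      rw [List.cons_append] at e2
      simpa [e2] using e1

lemma necklaceWord_isRotated {l l' : List Pearl} (h : l.count .square = 1) (hl : l ~r l') :
    necklaceWord l' = necklaceWord l := by
  obtain ⟨n, rfl⟩ := hl
  induction n with
  | zero => simp
  | succ n ih =>
    rw [← List.rotate_rotate, necklaceWord_rotate_one, ih]
    rw [← h]
    exact (List.rotate_perm l n).count_eq _

namespace PearlTree

lemma treeCycles_eq (τ : PearlTree) :
    treeCycles τ.root τ.limbs =
      ((τ.vertices.map fun c : List Pearl => (c : Cycle Pearl) : List (Cycle Pearl)) :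
        Multiset (Cycle Pearl)) := rfl

lemma size_eq (τ : PearlTree) : τ.size = (treeCycles τ.root τ.limbs).card := by
  simp [treeCycles_eq, size]

lemma size_eq_card_necklaces (τ : PearlTree) : τ.size = τ.necklaces.card := by
  simp [size, necklaces]

lemma HasNecklacesIn.oneSquare {Q : Set (List Bead)} {τ : PearlTree} (h : τ.HasNecklacesIn Q) :
    OneSquare (treeCycles τ.root τ.limbs) := by
  intro c hc
  rw [treeCycles_eq] at hc
  obtain ⟨l, hl, rfl⟩ := List.mem_map.1 (Multiset.mem_coe.1 hc)
  simpa using (h l hl).1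

lemma HasNecklacesIn.congr {Q : Set (List Bead)} {τ τ' : PearlTree} (h : τ.HasNecklacesIn Q)
    (e : treeCycles τ'.root τ'.limbs = treeCycles τ.root τ.limbs) : τ'.HasNecklacesIn Q := by
  intro c hc
  have : (c : Cycle Pearl) ∈ treeCycles τ'.root τ'.limbs := by
    rw [treeCycles_eq]
    exact Multiset.mem_coe.2 (List.mem_map_of_mem hc)
  rw [e, treeCycles_eq] at this
  obtain ⟨l, hl, hlc⟩ := List.mem_map.1 (Multiset.mem_coe.1 this)
  have hr : l ~r c := Cycle.coe_eq_coe.1 hlc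
  rw [← hr.perm.count_eq, necklaceWord_isRotated (h l hl).1 hr]
  exact h l hl

/-- Reduces preservation of necklaces to preservation of `treeCycles`; the representative `c.out` is
arbitrary. -/
lemma HasNecklacesIn.necklaces_eq {Q : Set (List Bead)} {τ : PearlTree}
    (h : τ.HasNecklacesIn Q) :
    τ.necklaces = (treeCycles τ.root τ.limbs).map fun c => necklaceWord c.out := by
  rw [treeCycles_eq, necklaces, Multiset.map_coe, List.map_map]
  congr 1
  refine List.map_congr_left fun l hl => ?_
  refine necklaceWord_isRotated ?_ ?_ |>.trans rfl |>.symm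
  · exact (h l hl).1
  · exact (Cycle.coe_eq_coe.1 (Quotient.out_eq (l : Cycle Pearl))).symm

end PearlTree

/-! ### Free pearls, walks and contours -/

namespace Limbs

lemma all_congr {r r' : Pearl → Pearl → Prop} {p p' : Pearl → Prop} {L : Limbs}
    (hr : ∀ x y, r x y → r' x y) (hp : ∀ x, p x → p' x) (h : L.All r p) : L.All r' p' := by
  rw [all_iff] at *
  exact ⟨fun e he => hr _ _ (h.1 e he), fun x hx => hp _ (h.2 x hx)⟩

lemma none_mem_walk {L : Limbs} (h : .triangle ∈ L.frees) : none ∈ L.walk := by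
  induction L with
  | nil => simp [frees] at h
  | free x rest ih =>
    rcases List.mem_cons.1 h with rfl | h
    · simp [walk, freeSteps]
    · simp [walk, ih h]
  | edge x y S rest ih1 ih2 =>
    rcases List.mem_append.1 h with h | h
    · simp [walk, ih1 h]
    · simp [walk, ih2 h]

lemma walk_eq_contour {r : Pearl → Pearl → Prop} {L : Limbs} (h : L.All r (· = .square)) :
    L.walk = L.contour.map some := by
  induction L with
  | nil => rfl
  | free x rest ih =>
    obtain ⟨rfl, h⟩ := h
    simp [walk, contour, ih h, freeSteps, cornerOfFree]
  | edge x y S rest ih1 ih2 =>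
    simp [walk, contour, ih1 h.2.1, ih2 h.2.2, linkedSteps]

lemma none_notMem_walk {r : Pearl → Pearl → Prop} {L : Limbs} (h : L.All r (· = .square)) :
    none ∉ L.walk := by
  simp [walk_eq_contour h]

lemma count_U_walk {r : Pearl → Pearl → Prop} {L : Limbs} (h : L.All r (· = .square)) :
    L.walk.count (some .U) = L.pearls.count .diamond := by
  have hl : ∀ x, (linkedSteps x).count (some .U) = [x].count .diamond := by
    rintro (_ | _ | _ | _) <;> decide
  induction L with
  | nil => rfl
  | free x rest ih =>
    obtain ⟨rfl, h⟩ := h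
    simp [walk, pearls, ih h, freeSteps]
  | edge x y S rest ih1 ih2 =>
    rw [walk, pearls, List.count_append, List.count_append, List.count_append, hl, hl, ih1 h.2.1,
      ih2 h.2.2, show x :: y :: (S.pearls ++ rest.pearls) = [x] ++ ([y] ++ (S.pearls ++ rest.pearls))
        from rfl]
    simp only [List.count_append]
    omega

/-- Regroups the pearls by vertex, so that their numbers depend only on the cyclic sequences and
survive rewiring and rerooting. -/
lemma coe_pearls (L : Limbs) :
    (L.pearls : Multiset Pearl) = ↑L.row + (L.cycles.map Cycle.toMultiset).sum := by
  induction L with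
  | nil => rfl
  | free x rest ih =>
    simp only [pearls, row, cycles_free, ← Multiset.cons_coe, ih, Multiset.cons_add]
  | edge x y S rest ih1 ih2 =>
    simp only [pearls, row, cycles_edge, ← Multiset.cons_coe, ← Multiset.coe_add, ih1, ih2,
      Multiset.map_cons, Multiset.sum_cons, Multiset.map_add, Multiset.sum_add,
      Cycle.coe_toMultiset]
    simp only [← Multiset.singleton_add]
    abel

lemma length_pearls (L : Limbs) : L.pearls.length = L.frees.length + 2 * L.cycles.card := by
  induction L with
  | nil => rfl
  | free x rest ih => simp [pearls, frees, ih]; omega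
  | edge x y S rest ih1 ih2 => simp [pearls, frees, ih1, ih2]; omega

lemma count_frees_le (x : Pearl) (L : Limbs) : L.frees.count x ≤ L.pearls.count x := by
  induction L with
  | nil => rfl
  | free y rest ih => simp only [pearls, frees, List.count_cons]; omega
  | edge y z S rest ih1 ih2 =>
    simp only [pearls, frees, List.count_cons, List.count_append]; omega

lemma finite_length_le (N : ℕ) : {L : Limbs | L.pearls.length ≤ N}.Finite := by
  have : Finite Bead := by
    refine Finite.of_injective (β := Fin 3)
      (fun b => match b with | .disc => 0 | .diamond => 1 | .triangle => 2) ?_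
    rintro (_ | _ | _) (_ | _ | _) <;> simp
  have : Finite Pearl := by
    refine Finite.of_injective Pearl.bead? ?_
    rintro (_ | _) (_ | _) <;> simp [Pearl.bead?]
  induction N with
  | zero =>
    refine (Set.finite_singleton nil).subset fun L hL => ?_
    cases L <;> simp_all [pearls]
  | succ N ih =>
    refine ((Set.finite_singleton nil).union (((Set.finite_univ.prod ih).image
      fun p : Pearl × Limbs => free p.1 p.2).union (((Set.finite_univ.prod
      (ih.prod ih)).image fun p : (Pearl × Pearl) × Limbs × Limbs =>
        edge p.1.1 p.1.2 p.2.1 p.2.2)))).subset fun L hL => ?_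
    cases L with
    | nil => exact Or.inl rfl
    | free x rest =>
      refine Or.inr (Or.inl ⟨(x, rest), ⟨trivial, ?_⟩, rfl⟩)
      simpa [pearls] using hL
    | edge x y S rest =>
      simp only [pearls, Set.mem_ofPred_eq, List.length_cons, List.length_append] at hL
      refine Or.inr (Or.inr ⟨((x, y), S, rest), ⟨trivial, ?_, ?_⟩, rfl⟩) <;>
        simp only [Set.mem_ofPred_eq] <;> omega

end Limbs

lemma PearlTree.coe_pearls (τ : PearlTree) :
    (τ.pearls : Multiset Pearl) =
      ((treeCycles τ.root τ.limbs).map Cycle.toMultiset).sum := by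
  simp only [PearlTree.pearls, treeCycles, Multiset.map_cons, Multiset.sum_cons,
    Cycle.coe_toMultiset, ← Multiset.cons_coe, Limbs.coe_pearls, Multiset.cons_add]

/-! ### The classes of trees -/

variable {Q : Set (List Bead)}

lemma mem_Csquare {τ : PearlTree} :
    τ ∈ Csquare Q ↔ τ.root = .square ∧ τ.HasNecklacesIn Q ∧ τ.limbs.All CEdge (· = .square) := by
  have : ∀ x : Pearl, x = .square ↔ (x ≠ .disc ∧ x ≠ .diamond) ∧ x ≠ .triangle := by
    rintro (_ | _ | _ | _) <;> simp
  have h2 : PearlTree.NoDefects τ ↔ ∀ x ∈ τ.limbs.frees, x ≠ .triangle := by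
    simp only [PearlTree.NoDefects]
    exact ⟨fun h x hx e => h (e ▸ hx), fun h hx => h _ hx rfl⟩
  rw [all_iff]
  simp only [Csquare, IsCompanionTree, Set.mem_ofPred_eq, h2, this, forall_and, CEdge]
  tauto

lemma mem_F₀ {τ : PearlTree} :
    τ ∈ F₀ Q ↔ τ.root = .square ∧ τ.HasNecklacesIn Q ∧ τ.limbs.All QEdge (· = .triangle) ∧
      τ.limbs.NonNeg ∧ excess τ.limbs.pearls = 0 := by
  rw [all_iff]
  simp only [F₀, IsNonNegQTree, IsQTree, Set.mem_ofPred_eq, QEdge, PearlTree.pearls]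
  constructor
  · rintro ⟨⟨⟨h1, h2⟩, h3, h4⟩, h5⟩
    rw [h1, excess_cons] at h5
    exact ⟨h1, h2.1, h2.2, h4, by simpa [excess] using h5⟩
  · rintro ⟨h1, h2, h3, h4, h5⟩
    rw [h1, excess_cons, h5]
    exact ⟨⟨⟨rfl, h2, h3⟩, by simp [excess], h4⟩, by simp [excess]⟩

lemma oneSquare_of_Csquare {τ : PearlTree} (h : τ ∈ Csquare Q) :
    .square ∉ τ.limbs.row ∧ OneSquare τ.limbs.cycles := by
  obtain ⟨h1, h2, -⟩ := mem_Csquare.1 h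
  have := h2.oneSquare
  rwa [h1, oneSquare_treeCycles_square] at this

lemma rise_of_Csquare {τ : PearlTree} (h : τ ∈ Csquare Q) : rise τ.limbs.walk = 0 := by
  obtain ⟨h1, h2, h3⟩ := mem_Csquare.1 h
  obtain ⟨h4, h5⟩ := oneSquare_of_Csquare h
  rw [rise_walk (all_congr (fun _ _ => id) (fun x hx => by simp [hx, CFree]) h3) h5,
    List.count_eq_zero.2 h4]
  rfl

/-- The root's down step precedes a word of rise 0. If that word goes below 0, the cycle lemma
yields a suffix `U m` with `m` a Dyck word, and this `U` matches the root cyclically. A word that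
ends with such a suffix and stays non-negative would end at positive height. -/
lemma balanced_iff {τ : PearlTree} (h : τ ∈ Csquare Q) :
    τ.Balanced ↔ run 0 τ.limbs.walk = some 0 := by
  obtain ⟨h1, h2, h3⟩ := mem_Csquare.1 h
  have h0 := rise_of_Csquare h
  have hn := none_notMem_walk h3
  rw [PearlTree.Balanced, PearlTree.contour, h1]
  rw [walk_eq_contour h3] at *
  generalize τ.limbs.contour = w at *
  simp only [cornerOfFree, List.singleton_append, ClosureMatches]
  constructor
  · intro H
    by_contra hc
    obtain ⟨a, b, e, hab⟩ := exists_conjugate hn h0 hc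
    obtain ⟨k, hk, hk'⟩ := run_append_eq_some.1 hab
    -- The conjugate steps down right after `b`, so `b` ends at positive height; its last ascent
    -- from height `k` is the up step matched with the root.
    obtain ⟨k, rfl, -⟩ := run_D.1 hk'
    obtain ⟨b, m, rfl, -, hm⟩ := exists_last_ascent (j := k) (by rw [e] at hn; simp_all) hk
      (by omega)
    rw [show k + 1 - k - 1 = 0 by omega] at hm
    obtain ⟨a', r', rfl, ha', hr'⟩ := List.map_eq_append_iff.1 e
    obtain ⟨d, r', rfl, hd, hr'⟩ := List.map_eq_cons_iff.1 hr'
    obtain ⟨b', r', rfl, hb', hr'⟩ := List.map_eq_append_iff.1 hr'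
    obtain ⟨u, m', rfl, hu, rfl⟩ := List.map_eq_cons_iff.1 hr'
    simp only [Option.some.injEq] at hd hu
    subst hd hu
    obtain ⟨m, rfl⟩ := exists_dyckWord hm
    have e2 : DyckStep.D :: (a' ++ .D :: (b' ++ .U :: m.toList)) =
        (.D :: (a' ++ .D :: b')) ++ .U :: m.toList := by simp
    refine H (DyckStep.D :: (a' ++ .D :: b')).length ⟨by simp, m, a' ++ .D :: b', ?_, ?_⟩
    · rw [e2, List.rotate_append_length_eq]; simp
    · rw [e2, List.length_append, List.length_cons (a := DyckStep.U), ← add_assoc, Nat.mod_self]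
  · rintro H i ⟨hi, m, r, e, hj⟩
    have hlen : (DyckStep.U :: (m.toList ++ .D :: r)).length = (DyckStep.D :: w).length := by
      rw [← e, List.length_rotate]
    simp only [List.length_cons, List.length_append] at hlen hi hj
    -- Less than two turns are made, so arriving at position 0 means exactly one: `m` runs up to the
    -- end of the word.
    have hi' : i + m.toList.length + 1 = w.length + 1 := by
      obtain ⟨c, hc⟩ := Nat.dvd_of_mod_eq_zero hj.symm
      have : c = 1 := by
        rcases c with _ | _ | c
        · omega
        · rfl
        · have : (w.length + 1) * (c + 1 + 1) = (w.length + 1) * c + 2 * (w.length + 1) := by ring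
          omega
      rw [this] at hc; omega
    rw [List.rotate_eq_drop_append_take (by simp; omega)] at e
    have e1 : (DyckStep.D :: w).drop i = .U :: m.toList := by
      have := congrArg (List.take (m.toList.length + 1)) e
      rw [List.take_append_of_le_length (by simp; omega), List.take_of_length_le (by simp; omega)]
        at this
      rw [this]
      simp
    have hi0 : i ≠ 0 := by
      rintro rfl
      simp at e1
    obtain ⟨i, rfl⟩ := Nat.exists_eq_succ_of_ne_zero hi0
    simp only [Nat.succ_eq_add_one, List.drop_succ_cons] at e1
    rw [← List.take_append_drop i w, e1, List.map_append] at H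
    obtain ⟨k, -, hk⟩ := run_append_eq_some.1 H
    have := run_rise hk
    have h5 := run_rise (run_dyckWord m)
    simp only [List.map_cons, rise_U] at this
    push_cast at *
    omega

lemma mem_B₀ {τ : PearlTree} :
    τ ∈ B₀ Q ↔ τ ∈ Csquare Q ∧ run 0 τ.limbs.walk = some 0 :=
  and_congr_right fun h => balanced_iff h

lemma mem_U₀ {τ : PearlTree} :
    τ ∈ U₀ Q ↔ τ ∈ Csquare Q ∧ run 0 τ.limbs.walk ≠ some 0 :=
  and_congr_right fun h => not_congr (balanced_iff h)

/-! ### The bijection between `F₀` and `B₀` -/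

lemma exists_rewire {τ : PearlTree} (h : τ ∈ F₀ Q) : ∃ L', Rewire τ.limbs L' := by
  obtain ⟨h1, h2, h3, h4, -⟩ := mem_F₀.1 h
  have := h2.oneSquare
  rw [h1, oneSquare_treeCycles_square] at this
  exact Rewire.exists_right h3 this.2 this.1 h4

lemma Rewire.mem_B₀ {τ τ' : PearlTree} (h : Rewire τ.limbs τ'.limbs) (hτ : τ ∈ F₀ Q)
    (hr : τ'.root = .square) : τ' ∈ B₀ Q := by
  obtain ⟨h1, h2, h3, h4, h5⟩ := mem_F₀.1 hτ
  -- Excess 0 leaves no marker, hence no defect.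
  have hn : none ∉ τ'.limbs.walk := by
    have := h.count_none
    rw [h5] at this
    exact List.count_eq_zero.1 (by exact_mod_cast this)
  have hall := (all_iff _ _ _).1 h.all_right
  refine _root_.mem_B₀.2 ⟨mem_Csquare.2 ⟨hr, h2.congr ?_, (all_iff _ _ _).2 ⟨hall.1, ?_⟩⟩,
    h.run_walk⟩
  · rw [hr, h1, h.treeCycles_eq]
  · intro x hx
    have := hall.2 x hx
    rcases x with _ | _ | _ | _
    · rfl
    · exact (this.1 rfl).elim
    · exact (this.2 rfl).elim
    · exact (hn (none_mem_walk hx)).elim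

lemma Rewire.mem_F₀ {τ τ' : PearlTree} (h : Rewire τ.limbs τ'.limbs) (hτ' : τ' ∈ B₀ Q)
    (hr : τ.root = .square) : τ ∈ F₀ Q := by
  have hC := (_root_.mem_B₀.1 hτ').1
  obtain ⟨h1, h2, h3⟩ := mem_Csquare.1 hC
  refine _root_.mem_F₀.2 ⟨hr, h2.congr ?_, h.all_left, h.nonneg, ?_⟩
  · rw [hr, h1, h.treeCycles_eq]
  · rw [← h.count_none, List.count_eq_zero.2 (none_notMem_walk h3)]
    rfl

lemma exists_rewire_left {τ : PearlTree} (h : τ ∈ B₀ Q) : ∃ L, Rewire L τ.limbs := by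
  obtain ⟨hC, hr⟩ := mem_B₀.1 h
  obtain ⟨h1, h2⟩ := oneSquare_of_Csquare hC
  refine Rewire.exists_left (all_congr (fun _ _ => id) (fun x hx => by simp [hx, CFree])
    (mem_Csquare.1 hC).2.2) h2 h1 hr

/-- Rewiring. -/
noncomputable def rewire (τ : F₀ Q) : B₀ Q :=
  ⟨⟨.square, (exists_rewire τ.2).choose⟩, (exists_rewire τ.2).choose_spec.mem_B₀ τ.2 rfl⟩

lemma rewire_spec (τ : F₀ Q) : Rewire τ.1.limbs (rewire τ).1.limbs :=
  (exists_rewire τ.2).choose_spec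

lemma ext_square {τ τ' : PearlTree} (h : τ.root = .square) (h' : τ'.root = .square)
    (hl : τ.limbs = τ'.limbs) : τ = τ' := by
  cases τ; cases τ'; simp_all

lemma rewire_bijective : Function.Bijective (rewire (Q := Q)) := by
  constructor
  · intro τ τ' h
    have h1 := rewire_spec τ
    rw [h] at h1
    exact Subtype.ext (ext_square (mem_F₀.1 τ.2).1 (mem_F₀.1 τ'.2).1
      (h1.left_unique (rewire_spec τ')))
  · intro τ'
    obtain ⟨L, hL⟩ := exists_rewire_left τ'.2
    refine ⟨⟨⟨.square, L⟩, Rewire.mem_F₀ (τ := ⟨.square, L⟩) hL τ'.2 rfl⟩, Subtype.ext ?_⟩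
    exact ext_square rfl (mem_Csquare.1 (mem_B₀.1 τ'.2).1).1
      ((rewire_spec ⟨⟨.square, L⟩, _⟩).right_unique hL)

noncomputable def rewireEquiv (Q : Set (List Bead)) : F₀ Q ≃ B₀ Q :=
  Equiv.ofBijective rewire rewire_bijective

lemma treeCycles_rewire (τ : F₀ Q) :
    treeCycles (rewire τ).1.root (rewire τ).1.limbs = treeCycles τ.1.root τ.1.limbs := by
  rw [(mem_F₀.1 τ.2).1, ← (rewire_spec τ).treeCycles_eq]
  rfl

lemma necklaces_congr {τ τ' : PearlTree} (h : τ.HasNecklacesIn Q)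
    (e : treeCycles τ'.root τ'.limbs = treeCycles τ.root τ.limbs) :
    τ'.necklaces = τ.necklaces := by
  rw [h.necklaces_eq, (h.congr e).necklaces_eq, e]

/-! ### Rerooting unbalanced trees -/

/-- The places of the free `□`-pearls, other than the root, on the walk. -/
abbrev SquarePlace (τ : PearlTree) : Type := {n : ℕ // τ.limbs.walk[n]? = some (some .D)}

lemma exists_spine {τ : PearlTree} (n : SquarePlace τ) :
    ∃ s : Spine, τ.limbs = s.plug (free .square) ∧ s.left.length = n := by
  obtain ⟨hn, h⟩ := List.getElem?_eq_some_iff.1 n.2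
  have e := (List.take_append_drop n.1 τ.limbs.walk).symm
  rw [List.drop_eq_getElem_cons hn, h] at e
  obtain ⟨s, x, h1, h2, h3, -⟩ := Spine.exists_plug (by simp) e
  obtain rfl := Rewire.square_of_freeSteps h2
  exact ⟨s, h1, by rw [h3, List.length_take]; omega⟩

lemma squarePlace_plug (s : Spine) :
    (s.plug (free .square)).walk[s.left.length]? = some (some .D) := by
  simp [Spine.walk_plug_free, freeSteps]

/-- The tree rerooted at the other end of the spine. -/
def reroot (s : Spine) : PearlTree := ⟨.square, s.rev.plug (free .square)⟩

lemma treeCycles_reroot {τ : PearlTree} {s : Spine} (hr : τ.root = .square)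
    (hs : τ.limbs = s.plug (free .square)) :
    treeCycles (reroot s).root (reroot s).limbs = treeCycles τ.root τ.limbs := by
  rw [hr, hs]
  exact s.treeCycles_rev _ _

lemma reroot_mem {τ : PearlTree} {s : Spine} (hτ : τ ∈ Csquare Q)
    (hs : τ.limbs = s.plug (free .square)) : reroot s ∈ Csquare Q := by
  obtain ⟨h1, h2, h3⟩ := mem_Csquare.1 hτ
  refine mem_Csquare.2 ⟨rfl, h2.congr (treeCycles_reroot h1 hs), ?_⟩
  rw [hs, Spine.all_plug] at h3
  rw [reroot, Spine.all_plug, Spine.all_rev CEdge.symm]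
  exact h3

/-- Moves the root to a free □ other than the balanced one; `conjugate_ne` shows that balance is
lost. -/
noncomputable def rerootAt (p : Σ τ : B₀ Q, SquarePlace τ.1) : U₀ Q := by
  refine ⟨reroot (exists_spine p.2).choose, ?_⟩
  have hs := (exists_spine p.2).choose_spec.1
  obtain ⟨h1, h2⟩ := mem_B₀.1 p.1.2
  rw [hs, Spine.walk_plug_free] at h2
  refine mem_U₀.2 ⟨reroot_mem h1 hs, ?_⟩
  rw [reroot, Spine.walk_plug_free, Spine.left_rev, Spine.right_rev]
  exact conjugate_ne h2

lemma rerootAt_spec (p : Σ τ : B₀ Q, SquarePlace τ.1) : ∃ s : Spine,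
    p.1.1.limbs = s.plug (free .square) ∧ s.left.length = p.2 ∧ (rerootAt p).1 = reroot s :=
  ⟨_, (exists_spine p.2).choose_spec.1, (exists_spine p.2).choose_spec.2, rfl⟩

/-- Uniqueness in the cycle lemma recovers the balanced root and thereby the path, hence
injectivity; existence gives surjectivity. -/
lemma rerootAt_bijective : Function.Bijective (rerootAt (Q := Q)) := by
  have hne : freeSteps .square ≠ [] := by simp [freeSteps]
  constructor
  · rintro ⟨τ, n⟩ ⟨τ', n'⟩ h
    obtain ⟨s, h1, h2, h3⟩ := rerootAt_spec ⟨τ, n⟩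
    obtain ⟨s', h1', h2', h3'⟩ := rerootAt_spec ⟨τ', n'⟩
    rw [h, h3', reroot, reroot, PearlTree.mk.injEq] at h3
    dsimp only at h1 h2 h1' h2'
    have r := (mem_B₀.1 τ.2).2
    have r' := (mem_B₀.1 τ'.2).2
    rw [h1, Spine.walk_plug_free] at r
    rw [h1', Spine.walk_plug_free] at r'
    have hw := congrArg walk h3.2
    simp only [Spine.walk_plug_free, Spine.left_rev, Spine.right_rev, freeSteps,
      List.singleton_append] at hw
    obtain ⟨e, -⟩ := Spine.plug_inj hne hne h3.2
      (by simp only [Spine.left_rev]; rw [conjugate_unique hw r' r])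
    have e : s' = s := by rw [← s'.rev_rev, e, s.rev_rev]
    subst e
    have : τ = τ' := Subtype.ext (ext_square (mem_Csquare.1 (mem_B₀.1 τ.2).1).1
      (mem_Csquare.1 (mem_B₀.1 τ'.2).1).1 (h1.trans h1'.symm))
    subst this
    have : n = n' := Subtype.ext (h2.symm.trans h2')
    rw [this]
  · intro τ
    obtain ⟨hC, hr⟩ := mem_U₀.1 τ.2
    obtain ⟨h1, h2, h3⟩ := mem_Csquare.1 hC
    obtain ⟨a, b, e, hab⟩ := exists_conjugate (none_notMem_walk h3) (rise_of_Csquare hC) hr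
    obtain ⟨s, x, h4, h5, rfl, rfl⟩ := Spine.exists_plug (by simp) e
    obtain rfl := Rewire.square_of_freeSteps h5
    have hB : reroot s ∈ B₀ Q := mem_B₀.2 ⟨reroot_mem hC h4, by
      rw [reroot, Spine.walk_plug_free, Spine.left_rev, Spine.right_rev]
      exact hab⟩
    -- The mark is the root of the unbalanced tree, which lies at the end of the reversed spine.
    refine ⟨⟨⟨reroot s, hB⟩, ⟨s.rev.left.length, squarePlace_plug s.rev⟩⟩, ?_⟩
    obtain ⟨t, h6, h7, h8⟩ :=
      rerootAt_spec ⟨⟨reroot s, hB⟩, ⟨s.rev.left.length, squarePlace_plug s.rev⟩⟩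
    obtain ⟨rfl, -⟩ := Spine.plug_inj hne hne h6 h7.symm
    refine Subtype.ext (h8.trans (ext_square rfl h1 ?_))
    rw [h4, reroot, Spine.rev_rev]

lemma treeCycles_rerootAt (p : Σ τ : B₀ Q, SquarePlace τ.1) :
    treeCycles (rerootAt p).1.root (rerootAt p).1.limbs =
      treeCycles p.1.1.root p.1.1.limbs := by
  obtain ⟨s, h1, -, h3⟩ := rerootAt_spec p
  rw [h3]
  exact treeCycles_reroot (mem_Csquare.1 (mem_B₀.1 p.1.2).1).1 h1

/-! ### Marked trees -/

lemma ncard_getElem?_eq {α : Type*} [BEq α] [LawfulBEq α] (l : List α) (a : α) :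
    {n : ℕ | l[n]? = some a}.Finite ∧ {n : ℕ | l[n]? = some a}.ncard = l.count a := by
  classical
  induction l with
  | nil => simp
  | cons x l ih =>
    have e : {n : ℕ | (x :: l)[n]? = some a} =
        (if x = a then {0} else ∅) ∪ Nat.succ '' {n : ℕ | l[n]? = some a} := by
      ext n
      cases n with
      | zero => by_cases h : x = a <;> simp [h]
      | succ n => by_cases h : x = a <;> simp [h]
    have hfin := ih.1.image Nat.succ
    have hdisj : Disjoint (if x = a then {0} else ∅ : Set ℕ)
        (Nat.succ '' {n : ℕ | l[n]? = some a}) := by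
      split_ifs <;> simp
    have hf0 : (if x = a then {0} else ∅ : Set ℕ).Finite := by
      split_ifs <;> simp
    rw [e]
    refine ⟨hf0.union hfin, ?_⟩
    rw [Set.ncard_union_eq hdisj hf0 hfin, Set.ncard_image_of_injective _ Nat.succ_injective, ih.2,
      List.count_cons]
    split_ifs <;> (simp_all; try omega)

/-- The walk has rise 0, so its down steps are as many as the ♦, and rewiring keeps the pearls. -/
lemma count_D_rewire (τ : F₀ Q) :
    (rewire τ).1.limbs.walk.count (some .D) = τ.1.pearls.count .diamond := by
  have hC := (mem_B₀.1 (rewire τ).2).1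
  have h0 := rise_of_Csquare hC
  have hU := count_U_walk (mem_Csquare.1 hC).2.2
  have hp : τ.1.pearls.count .diamond = (rewire τ).1.pearls.count .diamond := by
    rw [← Multiset.coe_count, ← Multiset.coe_count, PearlTree.coe_pearls, PearlTree.coe_pearls,
      treeCycles_rewire]
  rw [rise] at h0
  rw [hp, PearlTree.pearls, (mem_Csquare.1 hC).1, List.count_cons_of_ne (by simp), ← hU]
  omega

/-- Any bijection between ♦-pearls and free □-pearls will do, since marks do not affect necklaces;
equal cardinality suffices. -/
lemma exists_placeEquiv (τ : F₀ Q) :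
    Nonempty ({n : ℕ // τ.1.pearls[n]? = some Pearl.diamond} ≃ SquarePlace (rewire τ).1) := by
  obtain ⟨f1, c1⟩ := ncard_getElem?_eq τ.1.pearls Pearl.diamond
  obtain ⟨f2, c2⟩ := ncard_getElem?_eq (rewire τ).1.limbs.walk (some DyckStep.D)
  have := f1.to_subtype
  have := f2.to_subtype
  refine (Finite.card_eq (α := {n : ℕ | τ.1.pearls[n]? = some Pearl.diamond})
    (β := {n : ℕ | (rewire τ).1.limbs.walk[n]? = some (some DyckStep.D)})).1 ?_
  rw [Nat.card_coe_set_eq, Nat.card_coe_set_eq, c1, c2, count_D_rewire]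

def markedEquiv (Q : Set (List Bead)) :
    F₀diamond Q ≃ Σ τ : F₀ Q, {n : ℕ // τ.1.pearls[n]? = some Pearl.diamond} where
  toFun p := ⟨⟨p.1.1, p.2.1⟩, ⟨p.1.2, p.2.2⟩⟩
  invFun p := ⟨(p.1.1, p.2.1), p.1.2, p.2.2⟩
  left_inv _ := rfl
  right_inv _ := rfl

/-- From marked trees to unbalanced companion trees. -/
noncomputable def unbalancedEquiv (Q : Set (List Bead)) : F₀diamond Q ≃ U₀ Q :=
  ((markedEquiv Q).trans (Equiv.sigmaCongr (rewireEquiv Q)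
    fun τ => (exists_placeEquiv τ).some)).trans (Equiv.ofBijective rerootAt rerootAt_bijective)

lemma treeCycles_unbalancedEquiv (p : F₀diamond Q) :
    treeCycles (unbalancedEquiv Q p).1.root (unbalancedEquiv Q p).1.limbs =
      treeCycles p.1.1.root p.1.1.limbs :=
  (treeCycles_rerootAt _).trans (treeCycles_rewire ⟨p.1.1, p.2.1⟩)

lemma necklaces_rewireEquiv (τ : F₀ Q) : (rewireEquiv Q τ).1.necklaces = τ.1.necklaces :=
  necklaces_congr (mem_F₀.1 τ.2).2.1 (treeCycles_rewire τ)

lemma necklaces_unbalancedEquiv (p : F₀diamond Q) :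
    (unbalancedEquiv Q p).1.necklaces = p.1.1.necklaces :=
  necklaces_congr (mem_F₀.1 p.2.1).2.1 (treeCycles_unbalancedEquiv p)

lemma disjoint_B₀_U₀ (Q : Set (List Bead)) : Disjoint (B₀ Q) (U₀ Q) :=
  Set.disjoint_left.2 fun _ h h' => h'.2 h.2

lemma B₀_union_U₀ (Q : Set (List Bead)) : B₀ Q ∪ U₀ Q = Csquare Q := by
  ext τ
  simp only [B₀, U₀, Set.mem_union, Set.mem_ofPred_eq]
  tauto

theorem exists_necklacePreserving_equiv (Q : Set (List Bead)) :
    ∃ φ : (F₀ Q ⊕ F₀diamond Q) ≃ ((B₀ Q ∪ U₀ Q : Set PearlTree)),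
      (∀ τ : F₀ Q, (φ (Sum.inl τ)).1 ∈ B₀ Q ∧ (φ (Sum.inl τ)).1.necklaces = τ.1.necklaces) ∧
      (∀ p : F₀diamond Q, (φ (Sum.inr p)).1 ∈ U₀ Q ∧
        (φ (Sum.inr p)).1.necklaces = p.1.1.necklaces) := by
  classical
  refine ⟨(Equiv.sumCongr (rewireEquiv Q) (unbalancedEquiv Q)).trans
    (Equiv.Set.union (disjoint_B₀_U₀ Q)).symm, fun τ => ?_, fun p => ?_⟩
  · exact ⟨(rewireEquiv Q τ).2, necklaces_rewireEquiv τ⟩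
  · exact ⟨(unbalancedEquiv Q p).2, necklaces_unbalancedEquiv p⟩

/-! ### Finiteness and generating functions -/

section Equiv

variable {α β : Type} {S : Set α} {T : Set β} {f : α → ℕ} {g : β → ℕ}

lemma ncard_sep_congr (e : S ≃ T) (h : ∀ x, g (e x).1 = f x.1) (n : ℕ) :
    {a ∈ S | f a = n}.ncard = {b ∈ T | g b = n}.ncard := by
  refine Set.ncard_congr (fun a ha => (e ⟨a, ha.1⟩).1) (fun a ha => ⟨(e _).2, ?_⟩)
    (fun a b ha hb hab => ?_) fun b hb => ?_
  · exact (h _).trans ha.2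
  · simpa using e.injective (Subtype.ext hab)
  · refine ⟨e.symm ⟨b, hb.1⟩, ⟨(e.symm _).2, ?_⟩, by simp⟩
    have := h (e.symm ⟨b, hb.1⟩)
    rw [Equiv.apply_symm_apply] at this
    exact this.symm.trans hb.2

lemma finite_sep_congr (e : S ≃ T) (h : ∀ x, g (e x).1 = f x.1) (n : ℕ)
    (hT : {b ∈ T | g b = n}.Finite) : {a ∈ S | f a = n}.Finite := by
  have := hT.to_subtype
  have : Finite {a ∈ S | f a = n} :=
    Finite.of_injective (β := {b ∈ T | g b = n})
      (fun a => ⟨(e ⟨a.1, a.2.1⟩).1, (e _).2, (h _).trans a.2.2⟩) fun a b hab => by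
        have := e.injective (Subtype.ext (Subtype.mk.inj hab))
        exact Subtype.ext (Subtype.mk.inj this)
  exact Set.toFinite _

end Equiv

/-- Even for infinite `Q`: each vertex beyond the first brings two linked pearls, and the free
pearls are □, of which each vertex has one. So there are at most 3n pearls. -/
lemma finite_Csquare (Q : Set (List Bead)) (n : ℕ) : {τ ∈ Csquare Q | τ.size = n}.Finite := by
  refine ((finite_length_le (3 * n)).image (PearlTree.mk .square)).subset ?_
  rintro ⟨r, L⟩ ⟨h, rfl⟩
  obtain ⟨h1, h2, h3⟩ := mem_Csquare.1 h
  dsimp only at h1 h3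
  subst h1
  refine ⟨L, ?_, rfl⟩
  obtain ⟨h4, h5⟩ := oneSquare_of_Csquare h
  have e1 : L.frees.length = L.frees.count .square := by
    symm
    rw [List.count_eq_length]
    exact fun x hx => (((all_iff _ _ _).1 h3).2 x hx).symm
  have e2 : L.pearls.count .square = L.cycles.card := by
    have := congrArg (Multiset.count Pearl.square) (Limbs.coe_pearls L)
    rw [Multiset.coe_count, Multiset.count_add, Multiset.coe_count, List.count_eq_zero.2 h4,
      zero_add] at this
    rw [this, ← Multiset.coe_countAddMonoidHom, map_multiset_sum, Multiset.map_map]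
    rw [Multiset.map_congr (f := _ ∘ _) rfl (g := fun _ => 1) (by exact h5)]
    simp
  have := count_frees_le .square L
  have := length_pearls L
  simp only [Set.mem_ofPred_eq, PearlTree.size_eq, treeCycles, Multiset.card_cons]
  omega

lemma size_rewireEquiv (τ : F₀ Q) : (rewireEquiv Q τ).1.size = τ.1.size := by
  rw [PearlTree.size_eq_card_necklaces, necklaces_rewireEquiv, PearlTree.size_eq_card_necklaces]

lemma size_unbalancedEquiv (p : F₀diamond Q) : (unbalancedEquiv Q p).1.size = p.1.1.size := by
  rw [PearlTree.size_eq_card_necklaces, necklaces_unbalancedEquiv,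
    PearlTree.size_eq_card_necklaces]

lemma finite_B₀ (Q : Set (List Bead)) (n : ℕ) : {τ ∈ B₀ Q | τ.size = n}.Finite :=
  (finite_Csquare Q n).subset fun _ h => ⟨h.1.1, h.2⟩

lemma finite_U₀ (Q : Set (List Bead)) (n : ℕ) : {τ ∈ U₀ Q | τ.size = n}.Finite :=
  (finite_Csquare Q n).subset fun _ h => ⟨h.1.1, h.2⟩

lemma finite_F₀ (Q : Set (List Bead)) (n : ℕ) : {τ ∈ F₀ Q | τ.size = n}.Finite :=
  finite_sep_congr (rewireEquiv Q) size_rewireEquiv n (finite_B₀ Q n)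

lemma finite_F₀diamond (Q : Set (List Bead)) (n : ℕ) :
    {p ∈ F₀diamond Q | p.1.size = n}.Finite :=
  finite_sep_congr (f := fun p : PearlTree × ℕ => p.1.size) (unbalancedEquiv Q)
    size_unbalancedEquiv n (finite_U₀ Q n)

theorem genFun_F₀_add_genFun_F₀diamond (Q : Set (List Bead)) :
    genFun (F₀ Q) PearlTree.size + genFun (F₀diamond Q) (fun p => p.1.size) =
      genFun (Csquare Q) PearlTree.size := by
  ext n
  rw [map_add, genFun, genFun, genFun, PowerSeries.coeff_mk, PowerSeries.coeff_mk,
    PowerSeries.coeff_mk, ncard_sep_congr (rewireEquiv Q) size_rewireEquiv,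
    ncard_sep_congr (f := fun p : PearlTree × ℕ => p.1.size) (unbalancedEquiv Q)
      size_unbalancedEquiv, ← Set.ncard_union_eq _ (finite_B₀ Q n) (finite_U₀ Q n)]
  · congr 1
    rw [← B₀_union_U₀]
    ext τ
    simp only [Set.mem_union, Set.mem_ofPred_eq]
    tauto
  · exact Set.disjoint_left.2 fun τ h h' => Set.disjoint_left.1 (disjoint_B₀_U₀ Q) h.1 h'.1

/-! ### Calculus of generating functions -/

section GenFun

variable {α β : Type} {S S' : Set α} {T : Set β} {f : α → ℕ} {g : β → ℕ}

lemma coeff_genFun (S : Set α) (f : α → ℕ) (n : ℕ) :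
    (genFun S f).coeff n = {a ∈ S | f a = n}.ncard := PowerSeries.coeff_mk _ _

lemma genFun_union (h : Disjoint S S') (hS : ∀ n, {a ∈ S | f a = n}.Finite)
    (hS' : ∀ n, {a ∈ S' | f a = n}.Finite) :
    genFun (S ∪ S') f = genFun S f + genFun S' f := by
  ext n
  rw [map_add, coeff_genFun, coeff_genFun, coeff_genFun, ← Set.ncard_union_eq _ (hS n) (hS' n)]
  · congr 1
    ext a
    simp only [Set.mem_union, Set.mem_ofPred_eq]
    tauto
  · exact Set.disjoint_left.2 fun a h1 h2 => Set.disjoint_left.1 h h1.1 h2.1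

lemma genFun_image (φ : α → β) (hφ : Set.InjOn φ S) (h : ∀ a ∈ S, g (φ a) = f a) :
    genFun (φ '' S) g = genFun S f := by
  ext n
  rw [coeff_genFun, coeff_genFun]
  exact (ncard_sep_congr (Equiv.Set.imageOfInjOn φ S hφ) (fun x => h x.1 x.2) n).symm

lemma genFun_succ (S : Set α) (f : α → ℕ) :
    genFun S (fun a => f a + 1) = PowerSeries.X * genFun S f := by
  ext n
  cases n with
  | zero => simp [coeff_genFun]
  | succ n => rw [PowerSeries.coeff_succ_X_mul, coeff_genFun, coeff_genFun]; simp

lemma genFun_singleton {a : α} (h : f a = 0) : genFun {a} f = 1 := by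
  ext n
  rw [coeff_genFun, PowerSeries.coeff_one]
  split_ifs with hn
  · subst hn
    rw [Set.ncard_eq_one]
    refine ⟨a, ?_⟩
    ext b
    simp only [Set.mem_ofPred_eq, Set.mem_singleton_iff]
    exact ⟨fun h => h.1, fun e => ⟨e, e ▸ h⟩⟩
  · rw [Set.ncard_eq_zero (Set.toFinite _)]
    ext b
    simp only [Set.mem_ofPred_eq, Set.mem_singleton_iff, Set.mem_empty_iff_false, iff_false]
    rintro ⟨rfl, rfl⟩
    exact hn h

lemma genFun_prod (hS : ∀ n, {a ∈ S | f a = n}.Finite) (hT : ∀ n, {b ∈ T | g b = n}.Finite) :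
    genFun (S ×ˢ T) (fun p => f p.1 + g p.2) = genFun S f * genFun T g := by
  classical
  ext n
  rw [PowerSeries.coeff_mul, coeff_genFun]
  have hfin : {p ∈ S ×ˢ T | f p.1 + g p.2 = n}.Finite := by
    refine (Set.Finite.biUnion (Finset.HasAntidiagonal.antidiagonal n).finite_toSet
      fun q _ => (hS q.1).prod (hT q.2)).subset ?_
    rintro ⟨a, b⟩ ⟨⟨ha, hb⟩, h⟩
    simp only [Set.mem_iUnion]
    exact ⟨(f a, g b), by simpa using h, ⟨ha, rfl⟩, ⟨hb, rfl⟩⟩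
  rw [Set.ncard_eq_toFinset_card _ hfin, Finset.card_eq_sum_card_fiberwise
    (f := fun p => (f p.1, g p.2)) (t := Finset.HasAntidiagonal.antidiagonal n)
    (fun p hp => by
      have := (hfin.mem_toFinset.1 hp).2
      simpa using this)]
  refine Finset.sum_congr rfl fun q hq => ?_
  rw [coeff_genFun, coeff_genFun, ← Set.ncard_prod, ← Set.ncard_coe_finset]
  congr 1
  ext ⟨a, b⟩
  have hq' := Finset.HasAntidiagonal.mem_antidiagonal.1 hq
  simp only [Finset.coe_filter, Set.Finite.mem_toFinset, Set.mem_ofPred_eq, Set.mem_prod, Prod.ext_iff]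
  constructor
  · rintro ⟨⟨⟨h1, h2⟩, -⟩, h3, h4⟩
    exact ⟨⟨h1, h3⟩, h2, h4⟩
  · rintro ⟨⟨h1, h3⟩, h2, h4⟩
    exact ⟨⟨⟨h1, h2⟩, by rw [h3, h4, hq']⟩, h3, h4⟩

end GenFun

/-! ### Companion trees with necklaces `●●`, `▲` and `♦` -/

/-- The cyclic sequences of pearls of the necklaces `●●`, `▲` and `♦`. -/
def IsLambdaNecklace (c : List Pearl) : Prop := c.count .square = 1 ∧ necklaceWord c ∈ Qlambda

lemma isLambdaNecklace_iff (c : List Pearl) : IsLambdaNecklace c ↔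
    c ∈ ([[.square, .disc, .disc], [.disc, .square, .disc], [.disc, .disc, .square],
      [.square, .triangle], [.triangle, .square], [.square, .diamond], [.diamond, .square]] :
        List (List Pearl)) := by
  constructor
  · rintro ⟨h1, h2⟩
    obtain ⟨A, B, rfl, hA⟩ := List.eq_append_cons_of_mem
      (List.count_pos_iff.1 (by omega : 0 < c.count Pearl.square))
    have hB : .square ∉ B := by
      rw [List.count_append, List.count_cons_self] at h1
      exact List.count_eq_zero.1 (by omega)
    rw [necklaceWord_split hA] at h2
    have key : ∀ l : List Pearl, .square ∉ l →
        l = (l.filterMap Pearl.bead?).map Pearl.bead := by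
      intro l hl
      induction l with
      | nil => rfl
      | cons x l ih =>
        have := ih fun h => hl (List.mem_cons_of_mem _ h)
        rcases x with _ | b
        · simp at hl
        · exact congrArg (List.cons (Pearl.bead b)) this
    have h3 := key (B ++ A) (by simp [hA, hB])
    rcases h2 with h2 | h2 | h2 <;> rw [h2] at h3 <;>
      simp only [List.map_cons, List.map_nil, List.append_eq_cons_iff,
        List.cons_eq_append_iff, List.nil_eq_append_iff] at h3
    · rcases h3 with ⟨rfl, rfl⟩ | ⟨_, rfl, ⟨rfl, rfl⟩ | ⟨_, rfl, rfl, rfl⟩⟩ <;> simp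
    · rcases h3 with ⟨rfl, rfl⟩ | ⟨_, rfl, rfl, rfl⟩ <;> simp
    · rcases h3 with ⟨rfl, rfl⟩ | ⟨_, rfl, rfl, rfl⟩ <;> simp
  · have h1 : ([.disc, .disc] : List Bead) ∈ Qlambda := Or.inl rfl
    have h2 : ([.triangle] : List Bead) ∈ Qlambda := Or.inr (Or.inl rfl)
    have h3 : ([.diamond] : List Bead) ∈ Qlambda := Or.inr (Or.inr rfl)
    intro h
    simp only [List.mem_cons, List.not_mem_nil, or_false] at h
    rcases h with rfl | rfl | rfl | rfl | rfl | rfl | rfl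
    exacts [⟨rfl, h1⟩, ⟨rfl, h1⟩, ⟨rfl, h1⟩, ⟨rfl, h2⟩, ⟨rfl, h2⟩, ⟨rfl, h3⟩, ⟨rfl, h3⟩]

/-! ### Companion limbs counted according to the pearls of their first vertex. -/

/-- Limbs of companion trees with the given pearls on the first vertex. -/
def lambdaRow (w : List Pearl) : Set Limbs :=
  {L | L.row = w ∧ L.All CEdge (· = .square) ∧ ∀ c ∈ L.vertices, IsLambdaNecklace c}

/-- Limbs of companion trees that hang at a pearl `y`. -/
def lambdaLimbs (y : Pearl) : Set Limbs :=
  {L | IsLambdaNecklace (y :: L.row) ∧ L.All CEdge (· = .square) ∧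
    ∀ c ∈ L.vertices, IsLambdaNecklace c}

/-- The generating function of limbs, by the number of vertices beyond the first one. -/
noncomputable def limbsGenFun (S : Set Limbs) : ℕ⟦X⟧ := genFun S fun L => L.vertices.length

lemma finite_lambda {S : Set Limbs} (N : ℕ)
    (hS : ∀ L ∈ S, L.row.length ≤ N ∧ ∀ c ∈ L.vertices, IsLambdaNecklace c) (n : ℕ) :
    {L ∈ S | L.vertices.length = n}.Finite := by
  refine (finite_length_le (N + 3 * n)).subset ?_
  rintro L ⟨hL, rfl⟩
  obtain ⟨h1, h2⟩ := hS L hL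
  have key : ∀ m : Multiset (Cycle Pearl), (∀ c ∈ m, c.toMultiset.card ≤ 3) →
      (m.map Cycle.toMultiset).sum.card ≤ 3 * m.card := by
    intro m
    induction m using Multiset.induction_on with
    | empty => simp
    | cons c m ih =>
      intro h
      have := ih fun c hc => h c (Multiset.mem_cons_of_mem hc)
      have := h c (Multiset.mem_cons_self _ _)
      simp only [Multiset.map_cons, Multiset.sum_cons, Multiset.card_add, Multiset.card_cons]
      omega
  have h3 := key L.cycles fun c hc => by
    obtain ⟨l, hl, rfl⟩ := List.mem_map.1 (Multiset.mem_coe.1 hc)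
    have := (isLambdaNecklace_iff l).1 (h2 l hl)
    simp only [List.mem_cons, List.not_mem_nil, or_false] at this
    rcases this with rfl | rfl | rfl | rfl | rfl | rfl | rfl <;> simp
  have h4 := congrArg Multiset.card (Limbs.coe_pearls L)
  rw [Multiset.card_add, Multiset.coe_card, Multiset.coe_card] at h4
  rw [card_cycles] at h3
  simp only [Set.mem_ofPred_eq]
  omega

lemma finite_lambdaRow (w : List Pearl) (n : ℕ) :
    {L ∈ lambdaRow w | L.vertices.length = n}.Finite :=
  finite_lambda (S := lambdaRow w) w.length (fun _ h => ⟨h.1 ▸ le_rfl, h.2.2⟩) n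

lemma finite_lambdaLimbs (y : Pearl) (n : ℕ) :
    {L ∈ lambdaLimbs y | L.vertices.length = n}.Finite := by
  refine finite_lambda 3 (fun L h => ⟨?_, h.2.2⟩) n
  have := (isLambdaNecklace_iff _).1 h.1
  simp only [List.mem_cons, List.not_mem_nil, or_false] at this
  have : (y :: L.row).length ≤ 3 := by
    rcases this with h | h | h | h | h | h | h <;> rw [h] <;> simp
  simp at this
  omega

lemma disjoint_lambdaRow {w w' : List Pearl} (h : w ≠ w') :
    Disjoint (lambdaRow w) (lambdaRow w') :=
  Set.disjoint_left.2 fun _ h1 h2 => h (h1.1.symm.trans h2.1)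

lemma lambdaLimbs_square :
    lambdaLimbs .square = lambdaRow [.disc, .disc] ∪ (lambdaRow [.triangle] ∪
      lambdaRow [.diamond]) := by
  ext L
  simp only [lambdaLimbs, lambdaRow, isLambdaNecklace_iff, Set.mem_union, Set.mem_ofPred_eq,
    List.mem_cons, List.cons.injEq, List.not_mem_nil]
  simp
  tauto

/-- Either of the two ● of `●●` may be the linked one, whence the factor 2 in the equation for what
hangs at a □. -/
lemma lambdaLimbs_disc :
    lambdaLimbs .disc = lambdaRow [.disc, .square] ∪ lambdaRow [.square, .disc] := by
  ext L
  simp only [lambdaLimbs, lambdaRow, isLambdaNecklace_iff, Set.mem_union, Set.mem_ofPred_eq,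
    List.mem_cons, List.cons.injEq, List.not_mem_nil]
  simp
  tauto

lemma lambdaLimbs_triangle : lambdaLimbs .triangle = lambdaRow [.square] := by
  ext L
  simp only [lambdaLimbs, lambdaRow, isLambdaNecklace_iff, Set.mem_ofPred_eq,
    List.mem_cons, List.cons.injEq, List.not_mem_nil]
  simp

lemma lambdaLimbs_diamond : lambdaLimbs .diamond = lambdaRow [.square] := by
  ext L
  simp only [lambdaLimbs, lambdaRow, isLambdaNecklace_iff, Set.mem_ofPred_eq,
    List.mem_cons, List.cons.injEq, List.not_mem_nil]
  simp

lemma edge_nil_mem_lambdaRow {x y : Pearl} {S : Limbs} :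
    edge x y S nil ∈ lambdaRow [x] ↔ CEdge x y ∧ S ∈ lambdaLimbs y := by
  simp only [lambdaRow, lambdaLimbs, Set.mem_ofPred_eq, row, Limbs.All, vertices, List.append_nil,
    List.forall_mem_cons]
  tauto

lemma eq_of_mem_lambdaRow_singleton {x : Pearl} {L : Limbs} (h : L ∈ lambdaRow [x]) :
    (L = free x nil ∧ x = .square) ∨ ∃ y S, L = edge x y S nil := by
  obtain ⟨h1, h2, -⟩ := h
  have hnil : ∀ M : Limbs, M.row = [] → M = nil := by
    intro M hM
    cases M <;> simp_all [row]
  cases L with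
  | nil => simp [row] at h1
  | free z R =>
    simp only [row, List.cons.injEq] at h1
    obtain ⟨rfl, h1⟩ := h1
    rw [hnil R h1]
    exact Or.inl ⟨rfl, h2.1⟩
  | edge z y S R =>
    simp only [row, List.cons.injEq] at h1
    obtain ⟨rfl, h1⟩ := h1
    rw [hnil R h1]
    exact Or.inr ⟨y, S, rfl⟩

lemma limbsGenFun_edge (x y : Pearl) :
    limbsGenFun ((fun S => edge x y S nil) '' lambdaLimbs y) =
      PowerSeries.X * limbsGenFun (lambdaLimbs y) := by
  rw [limbsGenFun, limbsGenFun, ← genFun_succ]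
  refine genFun_image _ (fun S _ S' _ h => ?_) fun S _ => by simp [vertices]
  simpa using h

lemma limbsGenFun_lambdaRow_linked {x y : Pearl} (hx : x ≠ .square)
    (hy : ∀ z, CEdge x z ↔ z = y) :
    limbsGenFun (lambdaRow [x]) = PowerSeries.X * limbsGenFun (lambdaLimbs y) := by
  rw [← limbsGenFun_edge x y]
  congr 1
  ext L
  constructor
  · intro h
    obtain ⟨-, h'⟩ | ⟨z, S, rfl⟩ := eq_of_mem_lambdaRow_singleton h
    · exact (hx h').elim
    · obtain ⟨h1, h2⟩ := edge_nil_mem_lambdaRow.1 h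
      rw [hy] at h1
      subst h1
      exact ⟨S, h2, rfl⟩
  · rintro ⟨S, hS, rfl⟩
    exact edge_nil_mem_lambdaRow.2 ⟨(hy y).2 rfl, hS⟩

/-- A □ other than the root is the only kind of pearl with a choice: free, or linked to a ●. -/
lemma limbsGenFun_lambdaRow_square :
    limbsGenFun (lambdaRow [.square]) = 1 + PowerSeries.X * limbsGenFun (lambdaLimbs .disc) := by
  have e : lambdaRow [.square] =
      {free .square nil} ∪ (fun S => edge .square .disc S nil) '' lambdaLimbs .disc := by
    ext L
    constructor
    · intro h
      obtain ⟨rfl, -⟩ | ⟨z, S, rfl⟩ := eq_of_mem_lambdaRow_singleton h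
      · exact Or.inl rfl
      · obtain ⟨h1, h2⟩ := edge_nil_mem_lambdaRow.1 h
        have : z = .disc := by simpa [CEdge, Joins] using h1
        subst this
        exact Or.inr ⟨S, h2, rfl⟩
    · rintro (rfl | ⟨S, hS, rfl⟩)
      · simp [lambdaRow, row, Limbs.All, vertices]
      · exact edge_nil_mem_lambdaRow.2 ⟨by simp [CEdge, Joins], hS⟩
  have hf := finite_lambdaRow [.square]
  rw [← limbsGenFun_edge .square .disc]
  conv_lhs => rw [e]
  rw [e] at hf
  rw [limbsGenFun, genFun_union, genFun_singleton, limbsGenFun]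
  · rfl
  · simp
  · exact fun n => (hf n).subset fun L h => ⟨Or.inl h.1, h.2⟩
  · exact fun n => (hf n).subset fun L h => ⟨Or.inr h.1, h.2⟩

lemma vertices_append (L M : Limbs) : (L ++ M).vertices = L.vertices ++ M.vertices := by
  induction L <;> simp_all [vertices]

lemma limbsGenFun_lambdaRow_pair (x y : Pearl) :
    limbsGenFun (lambdaRow [x, y]) = limbsGenFun (lambdaRow [x]) * limbsGenFun (lambdaRow [y]) := by
  have e : lambdaRow [x, y] = (fun p : Limbs × Limbs => p.1 ++ p.2) ''
      (lambdaRow [x] ×ˢ lambdaRow [y]) := by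
    ext L
    constructor
    · rintro ⟨h1, h2, h3⟩
      cases L with
      | nil => simp [row] at h1
      | free z R =>
        simp only [row, List.cons.injEq] at h1
        obtain ⟨rfl, h1⟩ := h1
        refine ⟨(free z nil, R), ⟨⟨rfl, ⟨h2.1, trivial⟩, by simp [vertices]⟩, h1, h2.2, h3⟩, rfl⟩
      | edge z z' S R =>
        simp only [row, List.cons.injEq] at h1
        obtain ⟨rfl, h1⟩ := h1
        refine ⟨(edge z z' S nil, R), ⟨⟨rfl, ⟨h2.1, h2.2.1, trivial⟩, fun c hc => h3 c ?_⟩, h1,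
          h2.2.2, fun c hc => h3 c ?_⟩, rfl⟩
        · simp only [vertices, List.append_nil, List.mem_cons] at hc
          simp only [vertices, List.mem_cons, List.mem_append]
          tauto
        · simp only [vertices, List.mem_cons, List.mem_append]
          tauto
    · rintro ⟨⟨L, M⟩, ⟨⟨h1, h2, h3⟩, h4, h5, h6⟩, rfl⟩
      dsimp only at *
      refine ⟨by rw [row_append, h1, h4]; rfl, (all_append _ _ _ _).2 ⟨h2, h5⟩, fun c hc => ?_⟩
      rw [vertices_append] at hc
      exact (List.mem_append.1 hc).elim (h3 c) (h6 c)
  rw [e, limbsGenFun, limbsGenFun, limbsGenFun, ← genFun_prod (finite_lambdaRow _)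
    (finite_lambdaRow _)]
  refine genFun_image _ ?_ fun p _ => by simp [vertices_append]
  rintro ⟨L, M⟩ ⟨h1, -⟩ ⟨L', M'⟩ ⟨h2, -⟩ h
  dsimp only at *
  obtain ⟨rfl, -⟩ | ⟨z, S, rfl⟩ := eq_of_mem_lambdaRow_singleton h1 <;>
  obtain ⟨rfl, -⟩ | ⟨z', S', rfl⟩ := eq_of_mem_lambdaRow_singleton h2 <;> simp_all

lemma genFun_Csquare_Qlambda :
    genFun (Csquare Qlambda) PearlTree.size =
      PowerSeries.X * limbsGenFun (lambdaLimbs .square) := by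
  rw [limbsGenFun, ← genFun_succ]
  have e : Csquare Qlambda = PearlTree.mk .square '' lambdaLimbs .square := by
    ext τ
    rw [mem_Csquare]
    constructor
    · rintro ⟨h1, h2, h3⟩
      obtain ⟨r, L⟩ := τ
      dsimp only at h1
      subst h1
      exact ⟨L, ⟨h2 _ List.mem_cons_self, h3, fun c hc => h2 c (List.mem_cons_of_mem _ hc)⟩, rfl⟩
    · rintro ⟨L, ⟨h1, h2, h3⟩, rfl⟩
      refine ⟨rfl, fun c hc => ?_, h2⟩
      rcases List.mem_cons.1 hc with rfl | hc
      · exact h1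
      · exact h3 c hc
  rw [e]
  exact genFun_image _ (fun L _ L' _ h => by simpa using h) fun L _ => rfl

/-- Here `r` counts what may hang at a □. A root vertex `●●` carries two companion trees. A root
vertex `▲` or `♦` is linked to a vertex of the other kind, which leaves one □ to continue from. A
linked □ leads to a `●●` whose remaining ● and □ carry a companion tree and a term of `r`. -/
lemma genFun_Csquare_Qlambda_eq :
    ∃ r : ℕ⟦X⟧, genFun (Csquare Qlambda) PearlTree.size = PowerSeries.X *
        (genFun (Csquare Qlambda) PearlTree.size ^ 2 + 2 * PowerSeries.X * r) ∧
      r = 1 + 2 * PowerSeries.X * genFun (Csquare Qlambda) PearlTree.size * r := by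
  have hd : limbsGenFun (lambdaRow [.disc]) =
      PowerSeries.X * limbsGenFun (lambdaLimbs .square) :=
    limbsGenFun_lambdaRow_linked (by simp) fun z => by simp [CEdge, Joins]
  have ht : limbsGenFun (lambdaRow [.triangle]) =
      PowerSeries.X * limbsGenFun (lambdaRow [.square]) := by
    rw [← lambdaLimbs_diamond]
    exact limbsGenFun_lambdaRow_linked (by simp) fun z => by simp [CEdge, Joins]
  have hm : limbsGenFun (lambdaRow [.diamond]) =
      PowerSeries.X * limbsGenFun (lambdaRow [.square]) := by
    rw [← lambdaLimbs_triangle]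
    exact limbsGenFun_lambdaRow_linked (by simp) fun z => by simp [CEdge, Joins]
  have hsub : ∀ {S S' : Set Limbs}, (∀ n, {L ∈ S ∪ S' | L.vertices.length = n}.Finite) →
      Disjoint S S' → limbsGenFun (S ∪ S') = limbsGenFun S + limbsGenFun S' := fun h hd =>
    genFun_union hd (fun n => (h n).subset fun L h => ⟨Or.inl h.1, h.2⟩)
      (fun n => (h n).subset fun L h => ⟨Or.inr h.1, h.2⟩)
  have hS : limbsGenFun (lambdaLimbs .square) = limbsGenFun (lambdaRow [.disc]) ^ 2 +
      2 * PowerSeries.X * limbsGenFun (lambdaRow [.square]) := by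
    have hf := finite_lambdaLimbs .square
    rw [lambdaLimbs_square] at hf ⊢
    rw [hsub hf, hsub (fun n => (hf n).subset fun L h => ⟨Or.inr h.1, h.2⟩), ht, hm,
      limbsGenFun_lambdaRow_pair]
    · ring
    · exact disjoint_lambdaRow (by simp)
    · exact Set.disjoint_union_right.2 ⟨disjoint_lambdaRow (by simp), disjoint_lambdaRow (by simp)⟩
  have hD : limbsGenFun (lambdaLimbs .disc) =
      2 * limbsGenFun (lambdaRow [.disc]) * limbsGenFun (lambdaRow [.square]) := by
    have hf := finite_lambdaLimbs .disc
    rw [lambdaLimbs_disc] at hf ⊢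
    rw [hsub hf, limbsGenFun_lambdaRow_pair, limbsGenFun_lambdaRow_pair]
    · ring
    · exact disjoint_lambdaRow (by simp)
  refine ⟨limbsGenFun (lambdaRow [.square]), ?_, ?_⟩ <;> rw [genFun_Csquare_Qlambda, ← hd]
  · conv_lhs => rw [hd, hS]
  · conv_lhs => rw [limbsGenFun_lambdaRow_square, hD]
    ring

theorem Csquare_Qlambda_cubic (C : ℤ⟦X⟧) :
    C * (1 - PowerSeries.X * C) * (1 - 2 * PowerSeries.X * C) = 2 * PowerSeries.X ^ 2 ↔
      C = (genFun (Csquare Qlambda) PearlTree.size).map (Nat.castRingHom ℤ) := by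
  set D := (genFun (Csquare Qlambda) PearlTree.size).map (Nat.castRingHom ℤ) with hD
  have hcubic : D * (1 - PowerSeries.X * D) * (1 - 2 * PowerSeries.X * D) =
      2 * PowerSeries.X ^ 2 := by
    obtain ⟨r, h1, h2⟩ := genFun_Csquare_Qlambda_eq
    have e1 := congrArg (PowerSeries.map (Nat.castRingHom ℤ)) h1
    have e2 := congrArg (PowerSeries.map (Nat.castRingHom ℤ)) h2
    simp only [map_mul, map_add, map_pow, PowerSeries.map_X, map_one, map_ofNat, ← hD] at e1 e2
    -- The second equation reads r(1 − 2tD) = 1, so the multiplier of the first one eliminates r.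
    linear_combination (1 - 2 * PowerSeries.X * D) * e1 + 2 * PowerSeries.X ^ 2 * e2
  refine ⟨fun h => ?_, fun h => h ▸ hcubic⟩
  -- The cofactor of C − D in the difference of two instances of the cubic; its constant term is 1.
  have hne : 1 - 3 * PowerSeries.X * (C + D) + 2 * PowerSeries.X ^ 2 *
      (C ^ 2 + C * D + D ^ 2) ≠ (0 : ℤ⟦X⟧) := by
    intro h0
    simpa using congrArg PowerSeries.constantCoeff h0
  have : (C - D) * (1 - 3 * PowerSeries.X * (C + D) + 2 * PowerSeries.X ^ 2 *
      (C ^ 2 + C * D + D ^ 2)) = 0 := by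
    linear_combination h - hcubic
  exact sub_eq_zero.1 ((mul_eq_zero.1 this).resolve_right hne)

/-! ### Closed planar `λ`-terms -/

namespace UBTree

def varCount : UBTree → ℕ
  | var => 1
  | abs t => t.varCount
  | app t u => t.varCount + u.varCount

def absCount : UBTree → ℕ
  | var => 0
  | abs t => t.absCount + 1
  | app t u => t.absCount + u.absCount

/-- No subtree at an abstraction has more abstractions than variables. -/
def IsBindable : UBTree → Prop
  | var => True
  | abs t => t.absCount + 1 ≤ t.varCount ∧ t.IsBindable
  | app t u => t.IsBindable ∧ u.IsBindable

lemma Abstractions_var : var.Abstractions = ∅ := by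
  ext p
  rcases p with _ | ⟨_ | _, p⟩ <;> simp [Abstractions, subtreeAt]

lemma Abstractions_abs (t : UBTree) :
    (abs t).Abstractions = insert [] (List.cons false '' t.Abstractions) := by
  ext p
  rcases p with _ | ⟨_ | _, p⟩ <;> simp [Abstractions, subtreeAt]

lemma Abstractions_app (t u : UBTree) : (app t u).Abstractions =
    List.cons false '' t.Abstractions ∪ List.cons true '' u.Abstractions := by
  ext p
  rcases p with _ | ⟨_ | _, p⟩ <;> simp [Abstractions, subtreeAt]

lemma Variables_var : var.Variables = {[]} := by
  ext p
  rcases p with _ | ⟨_ | _, p⟩ <;> simp [Variables, subtreeAt]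

lemma Variables_abs (t : UBTree) : (abs t).Variables = List.cons false '' t.Variables := by
  ext p
  rcases p with _ | ⟨_ | _, p⟩ <;> simp [Variables, subtreeAt]

lemma Variables_app (t u : UBTree) : (app t u).Variables =
    List.cons false '' t.Variables ∪ List.cons true '' u.Variables := by
  ext p
  rcases p with _ | ⟨_ | _, p⟩ <;> simp [Variables, subtreeAt]

lemma ncard_cons_union {S T : Set (List Bool)} (hS : S.Finite) (hT : T.Finite) :
    (List.cons false '' S ∪ List.cons true '' T).ncard = S.ncard + T.ncard := by
  rw [Set.ncard_union_eq _ (hS.image _) (hT.image _),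
    Set.ncard_image_of_injective _ List.cons_injective,
    Set.ncard_image_of_injective _ List.cons_injective]
  rw [Set.disjoint_left]
  rintro _ ⟨p, -, rfl⟩ ⟨q, -, h⟩
  simp at h

lemma finite_Abstractions (t : UBTree) : t.Abstractions.Finite := by
  induction t with
  | var => simp [Abstractions_var]
  | abs t ih => rw [Abstractions_abs]; exact (ih.image _).insert _
  | app t u ih1 ih2 => rw [Abstractions_app]; exact (ih1.image _).union (ih2.image _)

lemma finite_Variables (t : UBTree) : t.Variables.Finite := by
  induction t with
  | var => simp [Variables_var]
  | abs t ih => rw [Variables_abs]; exact ih.image _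
  | app t u ih1 ih2 => rw [Variables_app]; exact (ih1.image _).union (ih2.image _)

lemma ncard_Abstractions (t : UBTree) : t.Abstractions.ncard = t.absCount := by
  induction t with
  | var => simp [Abstractions_var, absCount]
  | abs t ih =>
    rw [Abstractions_abs, Set.ncard_insert_of_notMem (by simp) (t.finite_Abstractions.image _),
      Set.ncard_image_of_injective _ List.cons_injective, ih, absCount]
  | app t u ih1 ih2 =>
    rw [Abstractions_app, ncard_cons_union t.finite_Abstractions u.finite_Abstractions, ih1, ih2,
      absCount]

lemma ncard_Variables (t : UBTree) : t.Variables.ncard = t.varCount := by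
  induction t with
  | var => simp [Variables_var, varCount]
  | abs t ih =>
    rw [Variables_abs, Set.ncard_image_of_injective _ List.cons_injective, ih, varCount]
  | app t u ih1 ih2 =>
    rw [Variables_app, ncard_cons_union t.finite_Variables u.finite_Variables, ih1, ih2, varCount]

/-! ### Bindings and the counting condition for their existence. -/

/-- A binding, as a map between addresses. -/
def Binds (t : UBTree) (m : List Bool → List Bool) : Prop :=
  Set.MapsTo m t.Abstractions t.Variables ∧ Set.InjOn m t.Abstractions ∧
    ∀ p ∈ t.Abstractions, p <+: m p

lemma Binds.absCount_le {t : UBTree} {m : List Bool → List Bool} (h : t.Binds m) :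
    t.absCount ≤ t.varCount := by
  rw [← ncard_Abstractions, ← ncard_Variables]
  exact Set.ncard_le_ncard_of_injOn m h.1 h.2.1 t.finite_Variables

/-- Bindings restrict to subtrees. -/
lemma Binds.restrict {t u : UBTree} {m : List Bool → List Bool} (h : t.Binds m) (b : Bool)
    (hA : ∀ p ∈ u.Abstractions, b :: p ∈ t.Abstractions)
    (hV : ∀ p, b :: p ∈ t.Variables → p ∈ u.Variables) :
    u.Binds fun p => (m (b :: p)).tail := by
  have key : ∀ p ∈ u.Abstractions, ∃ q, m (b :: p) = b :: q ∧ p <+: q ∧ q ∈ u.Variables := by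
    intro p hp
    obtain ⟨q, hq⟩ := h.2.2 _ (hA p hp)
    refine ⟨p ++ q, hq.symm, List.prefix_append _ _, hV _ ?_⟩
    have := h.1 (hA p hp)
    rwa [← hq] at this
  refine ⟨fun p hp => ?_, fun p hp p' hp' e => ?_, fun p hp => ?_⟩
  · obtain ⟨q, h1, -, h3⟩ := key p hp
    simpa [h1] using h3
  · obtain ⟨q, h1, -, -⟩ := key p hp
    obtain ⟨q', h1', -, -⟩ := key p' hp'
    simp only [h1, h1', List.tail_cons] at e
    have := h.2.1 (hA p hp) (hA p' hp') (by rw [h1, h1', e])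
    simpa using this
  · obtain ⟨q, h1, h2, -⟩ := key p hp
    simpa [h1] using h2

lemma Binds.isBindable {t : UBTree} {m : List Bool → List Bool} (h : t.Binds m) :
    t.IsBindable := by
  induction t generalizing m with
  | var => trivial
  | abs t ih =>
    exact ⟨h.absCount_le, ih (h.restrict false (fun p hp => by simp [Abstractions_abs, hp])
      fun p hp => by simpa [Variables_abs] using hp)⟩
  | app t u ih1 ih2 =>
    exact ⟨ih1 (h.restrict false (fun p hp => by simp [Abstractions_app, hp])
        fun p hp => by simpa [Variables_app] using hp),
      ih2 (h.restrict true (fun p hp => by simp [Abstractions_app, hp])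
        fun p hp => by simpa [Variables_app] using hp)⟩

/-- Bind from the leaves upwards: when an abstraction is reached, those below it are bound
injectively and the count leaves a variable `v` unused. -/
lemma IsBindable.exists_binds {t : UBTree} (h : t.IsBindable) : ∃ m, t.Binds m := by
  induction t with
  | var => exact ⟨id, by simp [Binds, Abstractions_var, Set.MapsTo]⟩
  | abs t ih =>
    obtain ⟨m, h1, h2, h3⟩ := ih h.2
    have : ∃ v ∈ t.Variables, v ∉ m '' t.Abstractions := by
      refine Set.exists_mem_notMem_of_ncard_lt_ncard ?_ (t.finite_Abstractions.image _)
      rw [h2.ncard_image, ncard_Abstractions, ncard_Variables]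
      exact h.1
    obtain ⟨v, hv, hv'⟩ := this
    refine ⟨fun p => match p with
      | [] => false :: v
      | _ :: p => false :: m p, ?_, ?_, ?_⟩
    · rintro p hp
      rw [Abstractions_abs] at hp
      rw [Variables_abs]
      obtain rfl | ⟨p, hp, rfl⟩ := hp
      · exact ⟨v, hv, rfl⟩
      · exact ⟨m p, h1 hp, rfl⟩
    · rw [Abstractions_abs]
      rintro _ (rfl | ⟨p, hp, rfl⟩) _ (rfl | ⟨q, hq, rfl⟩) e
      · rfl
      · simp only [List.cons.injEq, true_and] at e
        exact (hv' ⟨q, hq, e.symm⟩).elim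
      · simp only [List.cons.injEq, true_and] at e
        exact (hv' ⟨p, hp, e⟩).elim
      · simp only [List.cons.injEq, true_and] at e
        rw [h2 hp hq e]
    · rw [Abstractions_abs]
      rintro _ (rfl | ⟨p, hp, rfl⟩)
      · exact List.nil_prefix
      · simpa using h3 p hp
  | app t u ih1 ih2 =>
    obtain ⟨m, h1, h2, h3⟩ := ih1 h.1
    obtain ⟨m', h1', h2', h3'⟩ := ih2 h.2
    refine ⟨fun p => match p with
      | [] => []
      | false :: p => false :: m p
      | true :: p => true :: m' p, ?_, ?_, ?_⟩
    · intro p hp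
      rw [Abstractions_app] at hp
      rw [Variables_app]
      obtain ⟨p, hp, rfl⟩ | ⟨p, hp, rfl⟩ := hp
      · exact Or.inl ⟨m p, h1 hp, rfl⟩
      · exact Or.inr ⟨m' p, h1' hp, rfl⟩
    · rw [Abstractions_app]
      rintro _ (⟨p, hp, rfl⟩ | ⟨p, hp, rfl⟩) _ (⟨q, hq, rfl⟩ | ⟨q, hq, rfl⟩) e <;>
        simp at e
      · rw [h2 hp hq e]
      · rw [h2' hp hq e]
    · rw [Abstractions_app]
      rintro _ (⟨p, hp, rfl⟩ | ⟨p, hp, rfl⟩)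
      · simpa using h3 p hp
      · simpa using h3' p hp

/-- An injection between finite sets of the same size is onto, so once the counts agree any binding
leaves no variable free. -/
theorem isClosedPlanar_iff (t : UBTree) :
    t.IsClosedPlanar ↔ t.IsBindable ∧ t.varCount = t.absCount := by
  have := t.finite_Abstractions.to_subtype
  have := t.finite_Variables.to_subtype
  constructor
  · rintro ⟨m, ⟨h1, h2⟩, h3⟩
    classical
    refine ⟨Binds.isBindable (m := fun p => if hp : p ∈ t.Abstractions then (m ⟨p, hp⟩).1 else [])
      ⟨fun p hp => ?_, fun p hp q hq e => ?_, fun p hp => ?_⟩, ?_⟩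
    · simp only [hp, dif_pos]
      exact (m _).2
    · simp only [hp, hq, dif_pos] at e
      simpa using h1 (Subtype.ext e)
    · simp only [hp, dif_pos]
      exact h2 ⟨p, hp⟩
    · rw [← ncard_Abstractions, ← ncard_Variables, ← Nat.card_coe_set_eq, ← Nat.card_coe_set_eq]
      exact (Nat.card_eq_of_bijective m ⟨h1, h3⟩).symm
  · rintro ⟨h, e⟩
    obtain ⟨m, h1, h2, h3⟩ := h.exists_binds
    have hinj : Function.Injective fun a : t.Abstractions => (⟨m a.1, h1 a.2⟩ : t.Variables) :=
      fun a b hab => Subtype.ext (h2 a.2 b.2 (Subtype.mk.inj hab))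
    refine ⟨_, ⟨hinj, fun a => h3 a.1 a.2⟩, (hinj.bijective_of_nat_card_le ?_).2⟩
    rw [Nat.card_coe_set_eq, Nat.card_coe_set_eq, ncard_Abstractions, ncard_Variables, e]

/-! ### Unary-binary trees as `Q`-trees. -/

/-- The `Q`-tree of a unary-binary tree: `●●` at applications, `♦` at abstractions, `▲` at
variables. -/
def limbs : UBTree → Limbs
  | var => free .triangle nil
  | abs t => edge .diamond .square t.limbs nil
  | app t u => edge .disc .square t.limbs (edge .disc .square u.limbs nil)

lemma limbs_injective : Function.Injective limbs := by
  intro t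
  induction t with
  | var => intro u h; cases u <;> simp_all [limbs]
  | abs t ih =>
    intro u h
    cases u <;> simp [limbs] at h
    rw [ih h]
  | app t u ih1 ih2 =>
    intro v h
    cases v <;> simp [limbs] at h
    rw [ih1 h.1, ih2 h.2]

lemma excess_limbs (t : UBTree) : excess t.limbs.pearls = t.varCount - t.absCount := by
  induction t with
  | var => simp [limbs, pearls, excess, varCount, absCount]
  | abs t ih =>
    rw [limbs, pearls, excess_cons_cons, excess_append, ih]
    simp [pearls, excess, varCount, absCount]
    ring
  | app t u ih1 ih2 =>
    rw [limbs, pearls, excess_cons_cons, excess_append, ih1, pearls, excess_cons_cons,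
      excess_append, ih2]
    simp [pearls, excess, varCount, absCount]
    ring

lemma count_diamond_limbs (t : UBTree) : t.limbs.pearls.count .diamond = t.absCount := by
  induction t with
  | var => rfl
  | abs t ih => simp [limbs, pearls, absCount, ih]
  | app t u ih1 ih2 => simp [limbs, pearls, absCount, ih1, ih2]

/-- There is one application fewer than variables, and the first vertex is not counted: hence the 2.
-/
lemma length_vertices_limbs (t : UBTree) :
    t.limbs.vertices.length + 2 = 2 * t.varCount + t.absCount := by
  induction t with
  | var => rfl
  | abs t ih => simp [limbs, vertices, varCount, absCount]; omega
  | app t u ih1 ih2 => simp [limbs, vertices, varCount, absCount]; omega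

lemma IsBindable.absCount_le {t : UBTree} (h : t.IsBindable) : t.absCount ≤ t.varCount := by
  obtain ⟨m, hm⟩ := h.exists_binds
  exact hm.absCount_le

/-- The excess at a ♦ is the condition on that abstraction; the excess at the other pearls is then
non-negative by `IsBindable.absCount_le`. -/
lemma nonNeg_limbs (t : UBTree) : t.limbs.NonNeg ↔ t.IsBindable := by
  induction t with
  | var => simp [limbs, Limbs.NonNeg, IsBindable, excess]
  | abs t ih =>
    rw [limbs, Limbs.NonNeg, excess_cons_cons, excess_cons .square t.limbs.pearls, excess_limbs, ih]
    simp only [Limbs.NonNeg, IsBindable]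
    simp [excess]
    constructor
    · rintro ⟨h1, -, h2⟩
      exact ⟨by omega, h2⟩
    · rintro ⟨h1, h2⟩
      exact ⟨by omega, by omega, h2⟩
  | app t u ih1 ih2 =>
    rw [limbs, Limbs.NonNeg, Limbs.NonNeg, excess_cons_cons,
      excess_cons .square t.limbs.pearls, excess_limbs, excess_cons_cons,
      excess_cons .square u.limbs.pearls, excess_limbs, ih1, ih2]
    simp only [Limbs.NonNeg, IsBindable]
    have h1 := @IsBindable.absCount_le t
    have h2 := @IsBindable.absCount_le u
    simp [excess]
    tauto

lemma isLambdaNecklace_limbs (t : UBTree) : IsLambdaNecklace (.square :: t.limbs.row) ∧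
    ∀ c ∈ t.limbs.vertices, IsLambdaNecklace c := by
  induction t with
  | var => simp [limbs, row, vertices, isLambdaNecklace_iff]
  | abs t ih =>
    refine ⟨by simp [limbs, row, isLambdaNecklace_iff], ?_⟩
    simpa [limbs, vertices] using ih
  | app t u ih1 ih2 =>
    refine ⟨by simp [limbs, row, isLambdaNecklace_iff], fun c hc => ?_⟩
    simp only [limbs, vertices, List.mem_cons, List.mem_append, List.append_nil] at hc
    rcases hc with rfl | hc | rfl | hc
    exacts [ih1.1, ih1.2 c hc, ih2.1, ih2.2 c hc]

lemma all_limbs (t : UBTree) : t.limbs.All QEdge (· = .triangle) := by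
  induction t <;> simp_all [limbs, Limbs.All, QEdge, Joins]

lemma exists_limbs_eq {L : Limbs} (h : L.All QEdge (· = .triangle))
    (h1 : IsLambdaNecklace (.square :: L.row)) (h2 : ∀ c ∈ L.vertices, IsLambdaNecklace c) :
    ∃ t : UBTree, t.limbs = L := by
  suffices H : ∀ n, ∀ L : Limbs, L.vertices.length ≤ n → L.All QEdge (· = .triangle) →
      IsLambdaNecklace (.square :: L.row) → (∀ c ∈ L.vertices, IsLambdaNecklace c) →
      ∃ t : UBTree, t.limbs = L from H _ L le_rfl h h1 h2
  clear! L
  have hnil : ∀ M : Limbs, M.row = [] → M = nil := by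
    intro M hM
    cases M <;> simp_all [row]
  -- A ● or ♦ cannot be free, and its edge can only lead to a □.
  have hedge : ∀ {x : Pearl} {w : List Pearl} {L : Limbs}, x ≠ .square → x ≠ .triangle →
      L.row = x :: w → L.All QEdge (· = .triangle) →
      ∃ S R, L = edge x .square S R ∧ R.row = w := by
    intro x w L hx hx' hL hall
    cases L with
    | nil => simp [row] at hL
    | free z R =>
      simp only [row, List.cons.injEq] at hL
      exact (hx' (hL.1 ▸ hall.1)).elim
    | edge z y S R =>
      simp only [row, List.cons.injEq] at hL
      obtain ⟨rfl, hL⟩ := hL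
      have : y = .square := by
        rcases hall.1 with (⟨-, h⟩ | ⟨h, -⟩) | (⟨-, h⟩ | ⟨h, -⟩)
        exacts [h, (hx h).elim, h, (hx h).elim]
      subst this
      exact ⟨S, R, rfl, hL⟩
  intro n
  induction n using Nat.strong_induction_on with
  | _ n IH =>
  intro L hn h h1 h2
  have h3 : L.row = [.disc, .disc] ∨ L.row = [.triangle] ∨ L.row = [.diamond] := by
    simpa [isLambdaNecklace_iff] using h1
  rcases h3 with h3 | h3 | h3
  · obtain ⟨S, R, rfl, hR⟩ := hedge (by simp) (by simp) h3 h
    obtain ⟨S', R, rfl, hR'⟩ := hedge (by simp) (by simp) hR h.2.2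
    obtain rfl := hnil R hR'
    simp only [vertices, List.append_nil, List.length_cons, List.length_append] at hn
    simp only [vertices, List.append_nil, List.forall_mem_cons, List.forall_mem_append] at h2
    obtain ⟨t, rfl⟩ := IH _ (by omega) S le_rfl h.2.1 h2.1 h2.2.1
    obtain ⟨u, rfl⟩ := IH _ (by omega) S' le_rfl h.2.2.2.1 h2.2.2.1 h2.2.2.2
    exact ⟨app t u, rfl⟩
  · cases L with
    | nil => simp [row] at h3
    | free z R =>
      simp only [row, List.cons.injEq] at h3
      obtain ⟨rfl, h3⟩ := h3
      exact ⟨var, by rw [hnil R h3, limbs]⟩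
    | edge z y S R =>
      simp only [row, List.cons.injEq] at h3
      obtain ⟨rfl, h3⟩ := h3
      simpa [QEdge, Joins] using h.1
  · obtain ⟨S, R, rfl, hR⟩ := hedge (by simp) (by simp) h3 h
    obtain rfl := hnil R hR
    simp only [vertices, List.append_nil, List.length_cons] at hn
    simp only [vertices, List.append_nil, List.forall_mem_cons] at h2
    obtain ⟨t, rfl⟩ := IH _ (by omega) S le_rfl h.2.1 h2.1 h2.2
    exact ⟨abs t, rfl⟩

/-- The `Q`-tree of a unary-binary tree. -/
def toPearlTree (t : UBTree) : PearlTree := ⟨.square, t.limbs⟩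

lemma toPearlTree_injective : Function.Injective toPearlTree := fun _ _ h =>
  limbs_injective (PearlTree.mk.inj h).2

lemma toPearlTree_mem_F₀ {t : UBTree} : t.toPearlTree ∈ F₀ Qlambda ↔ t.IsClosedPlanar := by
  rw [mem_F₀, isClosedPlanar_iff, toPearlTree, nonNeg_limbs, excess_limbs]
  have : PearlTree.HasNecklacesIn Qlambda ⟨.square, t.limbs⟩ := by
    intro c hc
    rcases List.mem_cons.1 hc with rfl | hc
    · exact t.isLambdaNecklace_limbs.1
    · exact t.isLambdaNecklace_limbs.2 c hc
  simp only [this, t.all_limbs, true_and]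
  refine and_congr_right fun _ => ?_
  omega

lemma size_toPearlTree (t : UBTree) : t.toPearlTree.size + 1 = 2 * t.varCount + t.absCount :=
  t.length_vertices_limbs

lemma exists_toPearlTree {τ : PearlTree} (h : τ ∈ F₀ Qlambda) : ∃ t, toPearlTree t = τ := by
  obtain ⟨h1, h2, h3, -, -⟩ := mem_F₀.1 h
  obtain ⟨r, L⟩ := τ
  dsimp only at h1
  subst h1
  obtain ⟨t, rfl⟩ := exists_limbs_eq h3 (h2 _ List.mem_cons_self)
    fun c hc => h2 c (List.mem_cons_of_mem _ hc)
  exact ⟨t, rfl⟩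

lemma toPearlTree_image {n : ℕ} (hn : 1 ≤ n) :
    toPearlTree '' closedPlanarTerms n = {τ ∈ F₀ Qlambda | τ.size = 3 * n - 1} := by
  have key : ∀ t : UBTree, t.IsClosedPlanar →
      (t.Abstractions.ncard = n ↔ t.toPearlTree.size = 3 * n - 1) := by
    intro t ht
    have h1 := ((isClosedPlanar_iff t).1 ht).2
    have h2 := t.size_toPearlTree
    rw [ncard_Abstractions]
    omega
  ext τ
  constructor
  · rintro ⟨t, ⟨h1, h2⟩, rfl⟩
    exact ⟨toPearlTree_mem_F₀.2 h1, (key t h1).1 h2⟩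
  · rintro ⟨h1, h2⟩
    obtain ⟨t, rfl⟩ := exists_toPearlTree h1
    have := toPearlTree_mem_F₀.1 h1
    exact ⟨t, ⟨this, (key t this).2 h2⟩, rfl⟩

end UBTree

open UBTree in
-- At size 3n−1 every tree comes from a term with n abstractions, so it has n ♦ to mark.
lemma ncard_F₀diamond_Qlambda {n : ℕ} (hn : 1 ≤ n) :
    {p ∈ F₀diamond Qlambda | p.1.size = 3 * n - 1}.ncard =
      {τ ∈ F₀ Qlambda | τ.size = 3 * n - 1}.ncard * n := by
  classical
  have hf := finite_F₀diamond Qlambda (3 * n - 1)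
  have hf' := finite_F₀ Qlambda (3 * n - 1)
  rw [Set.ncard_eq_toFinset_card _ hf, Set.ncard_eq_toFinset_card _ hf',
    Finset.card_eq_sum_card_fiberwise (f := Prod.fst) (t := hf'.toFinset), Finset.sum_const_nat]
  · intro τ hτ
    have hτ := hf'.mem_toFinset.1 hτ
    have hcount : τ.pearls.count .diamond = n := by
      rw [← toPearlTree_image hn] at hτ
      obtain ⟨t, ⟨-, ht⟩, rfl⟩ := hτ
      rw [← ht, ncard_Abstractions, ← count_diamond_limbs]
      exact List.count_cons_of_ne (show Pearl.square ≠ Pearl.diamond by simp)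
    have h := ncard_getElem?_eq τ.pearls Pearl.diamond
    rw [hcount] at h
    refine Eq.trans ?_ h.2
    rw [← Set.ncard_image_of_injective _ (Prod.mk_right_injective τ),
      ← Set.ncard_coe_finset]
    congr 1
    ext ⟨σ, k⟩
    simp only [Finset.coe_filter, Set.Finite.mem_toFinset, Set.mem_ofPred_eq, Set.mem_image,
      Prod.mk.injEq]
    constructor
    · rintro ⟨⟨h1, h2⟩, rfl⟩
      exact ⟨k, h1.2, rfl, rfl⟩
    · rintro ⟨k, h1, rfl, rfl⟩
      exact ⟨⟨⟨hτ.1, h1⟩, hτ.2⟩, rfl⟩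
  · intro p hp
    have hp := hf.mem_toFinset.1 hp
    exact hf'.mem_toFinset.2 ⟨hp.1.1, hp.2⟩

open UBTree in
theorem closedPlanarTerms_count {n : ℕ} (hn : 1 ≤ n) :
    (closedPlanarTerms n).Finite ∧ ((closedPlanarTerms n).ncard : ℚ) =
      ((genFun (Csquare Qlambda) PearlTree.size).coeff (3 * n - 1) : ℚ) / (n + 1) := by
  have hinj := toPearlTree_injective.injOn (s := closedPlanarTerms n)
  constructor
  · refine Set.Finite.of_finite_image ?_ hinj
    rw [toPearlTree_image hn]
    exact finite_F₀ _ _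
  · rw [← genFun_F₀_add_genFun_F₀diamond, map_add, coeff_genFun, coeff_genFun,
      ncard_F₀diamond_Qlambda hn, ← toPearlTree_image hn, hinj.ncard_image]
    have : (n : ℚ) + 1 ≠ 0 := by positivity
    push_cast
    field_simp
    ring

theorem mainTheorem6 :
    (∀ Q : Set (List Bead),
      (∃ φ : (F₀ Q ⊕ F₀diamond Q) ≃ ((B₀ Q ∪ U₀ Q : Set PearlTree)),
        (∀ τ : F₀ Q, (φ (Sum.inl τ)).1 ∈ B₀ Q ∧
          (φ (Sum.inl τ)).1.necklaces = τ.1.necklaces) ∧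
        (∀ p : F₀diamond Q, (φ (Sum.inr p)).1 ∈ U₀ Q ∧
          (φ (Sum.inr p)).1.necklaces = p.1.1.necklaces)) ∧
      Disjoint (B₀ Q) (U₀ Q) ∧
      B₀ Q ∪ U₀ Q = Csquare Q ∧
      (∀ n, {τ ∈ F₀ Q | τ.size = n}.Finite ∧
        {p ∈ F₀diamond Q | p.1.size = n}.Finite ∧
        {τ ∈ Csquare Q | τ.size = n}.Finite) ∧
      genFun (F₀ Q) PearlTree.size + genFun (F₀diamond Q) (fun p => p.1.size) =
        genFun (Csquare Q) PearlTree.size) ∧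
    (∀ C : ℤ⟦X⟧,
      C * (1 - PowerSeries.X * C) * (1 - 2 * PowerSeries.X * C) = 2 * PowerSeries.X ^ 2 ↔
        C = (genFun (Csquare Qlambda) PearlTree.size).map (Nat.castRingHom ℤ)) ∧
    (∀ n : ℕ, 1 ≤ n →
      (closedPlanarTerms n).Finite ∧
      ((closedPlanarTerms n).ncard : ℚ) =
        ((genFun (Csquare Qlambda) PearlTree.size).coeff (3 * n - 1) : ℚ) / (n + 1)) := by
  refine ⟨fun Q => ⟨exists_necklacePreserving_equiv Q, disjoint_B₀_U₀ Q, B₀_union_U₀ Q,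
    fun n => ⟨finite_F₀ Q n, finite_F₀diamond Q n, finite_Csquare Q n⟩,
    genFun_F₀_add_genFun_F₀diamond Q⟩, Csquare_Qlambda_cubic, fun n hn =>
    closedPlanarTerms_count hn⟩
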